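/- Let $L\ge 1$ and let $\Lambda_L=(\mathbb Z/L)^3$ be the $L\times L\times L$ cubic lattice with periodic boundary conditions, with two qubits at each site. Denote the eight corners of the elementary cube based at $v\in\Lambda_L$ by monomials, $x^ay^bz^c$ with $a,b,c\in\{0,1\}$ standing for the site $v+(a,b,c)$. Let $G^Z_v$ be the product of $\sigma^z$ on the first qubit at the corners $xy,yz,zx,xyz$ and $\sigma^z$ on the second qubit at the corners $x,y,z,xyz$; let $G^X_v$ be the product of $\sigma^x$ on the first qubit at the corners $1,xy,yz,zx$ and $\sigma^x$ on the second qubit at the corners $1,x,y,z$. The cubic code is the Hamiltonian $$H_L=-\sum_{v\in\Lambda_L}\left(G^Z_v+G^X_v\right)$$ acting on $(\mathbb C^2)^{\otimes 2L^3}$. Then the ground-state degeneracy of $H_L$ (the dimension of the eigenspace of its least eigenvalue) is $2^{k(L)}$ for a nonnegative integer $k(L)$, the number of encoded qubits, and for every $L\ge1$ $$\frac{k(L)+2}{4}=\deg_x\gcd\left((1+x)^L+1,\ (1+\omega x)^L+1,\ (1+\omega^2x)^L+1\right),$$ where the gcd is taken in $\mathbb F_4[x]$ and $\omega\in\mathbb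 F_4$ satisfies $\omega^2+\omega+1=0$. In particular, for every integer $p\ge1$, $$\frac{k(L)+2}{4}=\begin{cases}1&\text{if }L=2^p+1,\\ L&\text{if }L=2^p,\\ L-2&\text{if }L=4^p-1,\\ 1&\text{if }L=2^{2p+1}-1.\end{cases}$$ Moreover, if $L=2^rL'$ with integers $r\ge0$ and $L'\ge1$, then $k(L)+2=2^r\left(k(L')+2\right)$. -/

import Mathlib

namespace CubicCode

/-- The Pauli matrix `σˣ`. -/
def sigmaX : Matrix (Fin 2) (Fin 2) ℂ := !![0, 1; 1, 0]

/-- The Pauli matrix `σᶻ`. -/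
def sigmaZ : Matrix (Fin 2) (Fin 2) ℂ := !![1, 0; 0, -1]

/-- The tensor product `⨂_q A q` of one-qubit operators, as a matrix on `(ℂ²)^{⊗ Q}` in the
computational basis, whose vectors are labelled by the bit strings `Q → Fin 2`. -/
def tensorOp {Q : Type*} [Fintype Q] (A : Q → Matrix (Fin 2) (Fin 2) ℂ) :
    Matrix (Q → Fin 2) (Q → Fin 2) ℂ :=
  Matrix.of fun s t => ∏ q, A q (s q) (t q)

/-- The sites of the `L × L × L` lattice with periodic boundary conditions. -/
abbrev Site (L : ℕ) : Type := ZMod L × ZMod L × ZMod L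

/-- There are two qubits at each site. -/
abbrev Qubit (L : ℕ) : Type := Site L × Fin 2

/-- The corners of the unit cube carrying `σᶻ` on the first, resp. second, qubit in the `Z`-type
interaction term: `xy, yz, zx, xyz` for the first qubit and `x, y, z, xyz` for the second. The
monomial `x ^ a * y ^ b * z ^ c` is written `(a, b, c)`. -/
def zCorners : Fin 2 → Finset (ℕ × ℕ × ℕ) :=
  ![{(1, 1, 0), (0, 1, 1), (1, 0, 1), (1, 1, 1)}, {(1, 0, 0), (0, 1, 0), (0, 0, 1), (1, 1, 1)}]

/-- The corners of the unit cube carrying `σˣ` on the first, resp. second, qubit in the `X`-type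
interaction term: `1, xy, yz, zx` for the first qubit and `1, x, y, z` for the second. -/
def xCorners : Fin 2 → Finset (ℕ × ℕ × ℕ) :=
  ![{(0, 0, 0), (1, 1, 0), (0, 1, 1), (1, 0, 1)}, {(0, 0, 0), (1, 0, 0), (0, 1, 0), (0, 0, 1)}]

/-- The site at corner `c` of the elementary cube based at `v`. -/
def cornerSite {L : ℕ} (v : Site L) (c : ℕ × ℕ × ℕ) : Site L :=
  (v.1 + c.1, v.2.1 + c.2.1, v.2.2 + c.2.2)

/-- The number of corners in the pattern `K` which, for the elementary cube based at `v`, lie on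
the qubit `q`. It is `0` or `1` for `2 ≤ L`; for `L = 1` all the corners of a cube coincide. -/
def multiplicity {L : ℕ} (K : Fin 2 → Finset (ℕ × ℕ × ℕ)) (v : Site L) (q : Qubit L) : ℕ :=
  ((K q.2).filter fun c => cornerSite v c = q.1).card

/-- The `Z`-type interaction term of the elementary cube based at `v`. -/
def zTerm (L : ℕ) [NeZero L] (v : Site L) : Matrix (Qubit L → Fin 2) (Qubit L → Fin 2) ℂ :=
  tensorOp fun q => sigmaZ ^ multiplicity zCorners v q

/-- The `X`-type interaction term of the elementary cube based at `v`. -/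
def xTerm (L : ℕ) [NeZero L] (v : Site L) : Matrix (Qubit L → Fin 2) (Qubit L → Fin 2) ℂ :=
  tensorOp fun q => sigmaX ^ multiplicity xCorners v q

/-- The Hamiltonian of the cubic code: the negative sum of the two interaction terms over all
elementary cubes of the periodic lattice. -/
def hamiltonian (L : ℕ) [NeZero L] : Matrix (Qubit L → Fin 2) (Qubit L → Fin 2) ℂ :=
  -∑ v : Site L, (zTerm L v + xTerm L v)

/-- The Hamiltonian `H` has a least eigenvalue `E` (the ground state energy), and the corresponding
eigenspace (the space of ground states) has dimension `d`. -/
def HasGroundStateDegeneracy {B : Type*} [Fintype B] [DecidableEq B] (H : Matrix B B ℂ) (d : ℕ) :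
    Prop :=
  ∃ E : ℝ, IsLeast {e : ℝ | Module.End.HasEigenvalue (Matrix.toLin' H) (e : ℂ)} E ∧
    Module.finrank ℂ (Module.End.eigenspace (Matrix.toLin' H) (E : ℂ)) = d

open Classical in
/-- The degree of `gcd ((1 + x) ^ L + 1, (1 + ω x) ^ L + 1, (1 + ω² x) ^ L + 1)` in `𝔽₄[x]`. -/
noncomputable def gcdDegree (ω : GaloisField 2 2) (L : ℕ) : ℕ :=
  (EuclideanDomain.gcd
    (EuclideanDomain.gcd
      ((1 + Polynomial.X) ^ L + 1 : Polynomial (GaloisField 2 2))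
      ((1 + Polynomial.C ω * Polynomial.X) ^ L + 1))
    ((1 + Polynomial.C (ω ^ 2) * Polynomial.X) ^ L + 1)).natDegree

end CubicCode

/-! The interaction terms are commuting Hermitian involutions of CSS type, so ground states are the
vectors fixed by all of them. In the computational basis these are the functions supported on the
kernel of the `Z` parity checks and invariant under the span of the `X` patterns. Since there are
twice as many qubits as cubes, rank-nullity turns their dimension into `2` to the number of linear
relations among the `Z` terms plus the number among the `X` terms. Inversion of the lattice
exchanges the two kinds of relations, so `k` is twice the dimension of one solution space
(`hasGroundStateDegeneracy_hamiltonian`).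

That space is dual to the quotient of the group algebra by `1 + x + y + z` and `1 + xy + yz + zx`,
and its dimension may be computed over `𝔽₄`. Eliminating `z` leaves a quadratic form in `x + 1, y +
1` which splits over `𝔽₄` as `u v = 0`: two lines meeting at a node. There `x = 1 + ω²u + ωv`, `y =
1 + u + v`, `z = 1 + ωu + ω²v`, and on each branch the conditions `x^L = y^L = z^L = 1` become the
vanishing of the three polynomials `(1 + αt)^L + 1`, `α³ = 1`, that is, of their gcd `g`. Two copies
of `F[t]/(g)` glued at the node have dimension `2 deg g - 1` (`finrank_add_one_of_node`), whence `k
+ 2 = 4 deg g`.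

The delicate point is the node: the conditions only give `u g(u) = 0` and `v g(v) = 0` at once, and
`aeval_nodeCoord_eq_zero` removes the extra factor. The special lengths follow from Frobenius and
explicit Bézout identities. -/

namespace CubicCode

open Matrix
open scoped ComplexOrder

/-! ### Ground states of a negative sum of Hermitian involutions -/

section Involutions

variable {B I : Type*} [Fintype B] [DecidableEq B] [Fintype I]

/-- The space of vectors fixed by every operator of a family. -/
def fixedSpace (T : I → Matrix B B ℂ) : Submodule ℂ (B → ℂ) where
  carrier := {ψ | ∀ i, T i *ᵥ ψ = ψ}
  add_mem' ha hb i := by rw [mulVec_add, ha i, hb i]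
  zero_mem' i := mulVec_zero _
  smul_mem' c ψ h i := by rw [mulVec_smul, h i]

omit [DecidableEq B] [Fintype I] in
theorem mem_fixedSpace {T : I → Matrix B B ℂ} {ψ : B → ℂ} :
    ψ ∈ fixedSpace T ↔ ∀ i, T i *ᵥ ψ = ψ := Iff.rfl

/-- `1 - T` is twice an orthogonal projection, so it equals half of `(1 - T)ᴴ * (1 - T)`. -/
theorem posSemidef_one_sub_of_involution {T : Matrix B B ℂ} (hT : T.IsHermitian)
    (h : T * T = 1) : (1 - T).PosSemidef := by
  have key : (1 - T) = (2⁻¹ : ℝ) • ((1 - T)ᴴ * (1 - T)) := by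
    have : (1 - T)ᴴ * (1 - T) = (2 : ℝ) • (1 - T) := by
      rw [conjTranspose_sub, conjTranspose_one, hT.eq, mul_sub, sub_mul, sub_mul, h, two_smul]
      simp only [one_mul, mul_one]
      abel
    rw [this, smul_smul]
    norm_num
  rw [key]
  exact (posSemidef_conjTranspose_mul_self _).smul (by norm_num)

theorem neg_sum_mulVec_add (T : I → Matrix B B ℂ) (ψ : B → ℂ) :
    (-∑ i, T i) *ᵥ ψ + (Fintype.card I : ℂ) • ψ = (∑ i, (1 - T i)) *ᵥ ψ := by
  rw [Finset.sum_sub_distrib, sub_mulVec, neg_mulVec]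
  simp only [Finset.sum_const, Finset.card_univ]
  rw [← Nat.cast_smul_eq_nsmul ℂ, smul_mulVec, one_mulVec]
  abel

/-- The ground space of a negative sum of Hermitian involutions is their common fixed space,
provided the latter is nontrivial. -/
theorem hasGroundStateDegeneracy_neg_sum (T : I → Matrix B B ℂ) (hT : ∀ i, (T i).IsHermitian)
    (h : ∀ i, T i * T i = 1) (hpos : 0 < Module.finrank ℂ (fixedSpace T)) :
    HasGroundStateDegeneracy (-∑ i, T i) (Module.finrank ℂ (fixedSpace T)) := by
  have hps : ∀ i, (1 - T i).PosSemidef := fun i => posSemidef_one_sub_of_involution (hT i) (h i)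
  have hsum : (∑ i, (1 - T i)).PosSemidef := posSemidef_sum _ fun i _ => hps i
  have heig : Module.End.eigenspace (toLin' (-∑ i, T i)) ((-(Fintype.card I : ℝ) : ℝ) : ℂ)
      = fixedSpace T := by
    ext ψ
    rw [Module.End.mem_eigenspace_iff, toLin'_apply, mem_fixedSpace]
    push_cast
    constructor
    · intro hψ i
      have h0 : (∑ i, (1 - T i)) *ᵥ ψ = 0 := by
        rw [← neg_sum_mulVec_add, hψ, neg_smul, neg_add_cancel]
      -- The shifted Hamiltonian is a sum of positive semidefinite terms, so a vector it kills is
      -- killed by every term.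
      have h1 : ∑ i, (star ψ ⬝ᵥ ((1 - T i) *ᵥ ψ)) = 0 := by
        rw [← dotProduct_sum, ← sum_mulVec, h0, dotProduct_zero]
      have h2 := (Finset.sum_eq_zero_iff_of_nonneg
        fun i _ => (hps i).dotProduct_mulVec_nonneg ψ).1 h1 i (Finset.mem_univ i)
      have h3 := ((hps i).dotProduct_mulVec_zero_iff ψ).1 h2
      rw [sub_mulVec, one_mulVec, sub_eq_zero] at h3
      exact h3.symm
    · intro hψ
      have h0 := neg_sum_mulVec_add T ψ
      have h1 : ∀ i, (1 - T i) *ᵥ ψ = 0 := fun i => by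
        rw [sub_mulVec, one_mulVec, hψ i, sub_self]
      rw [sum_mulVec, Finset.sum_eq_zero fun i _ => h1 i] at h0
      rw [neg_smul]
      exact eq_neg_of_add_eq_zero_left h0
  refine ⟨-(Fintype.card I : ℝ), ⟨?_, ?_⟩, by rw [heig]⟩
  · rw [Set.mem_ofPred_eq, Module.End.hasEigenvalue_iff, heig]
    intro hbot
    rw [hbot, finrank_bot] at hpos
    exact hpos.false
  · intro e he
    obtain ⟨ψ, hψ, hne⟩ := Module.End.HasEigenvalue.exists_hasEigenvector he
    rw [Module.End.mem_eigenspace_iff, toLin'_apply] at hψ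
    have h0 := neg_sum_mulVec_add T ψ
    rw [hψ, ← add_smul] at h0
    have h1 := hsum.dotProduct_mulVec_nonneg ψ
    rw [← h0, dotProduct_smul, smul_eq_mul] at h1
    have h2 : 0 < star ψ ⬝ᵥ ψ := dotProduct_star_self_pos_iff.2 hne
    have h3 : (0 : ℂ) ≤ (e : ℂ) + (Fintype.card I : ℂ) := by
      by_contra hcon
      have hreal : (e : ℂ) + (Fintype.card I : ℂ) = ((e + Fintype.card I : ℝ) : ℂ) := by
        push_cast; rfl
      rw [hreal] at hcon h1
      rw [Complex.zero_le_real, not_le] at hcon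
      have : ((e + Fintype.card I : ℝ) : ℂ) * (star ψ ⬝ᵥ ψ) < 0 :=
        mul_neg_of_neg_of_pos (by exact_mod_cast hcon) h2
      exact (this.trans_le h1).false
    have h4 : (0 : ℝ) ≤ e + Fintype.card I := by exact_mod_cast h3
    linarith

end Involutions

/-! ### Algebra of tensor products of one-qubit operators -/

section TensorOp

variable {Q : Type*} [Fintype Q]

theorem tensorOp_mul (A B : Q → Matrix (Fin 2) (Fin 2) ℂ) [DecidableEq Q] :
    tensorOp A * tensorOp B = tensorOp (fun q => A q * B q) := by
  ext s u
  simp only [tensorOp, mul_apply, of_apply, ← Finset.prod_mul_distrib, Finset.prod_univ_sum,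
    Fintype.piFinset_univ]

theorem tensorOp_one [DecidableEq Q] :
    tensorOp (fun _ : Q => (1 : Matrix (Fin 2) (Fin 2) ℂ)) = 1 := by
  ext s u
  simp only [tensorOp, of_apply, one_apply]
  by_cases h : s = u
  · simp [h]
  · obtain ⟨q, hq⟩ := Function.ne_iff.1 h
    rw [if_neg h]
    exact Finset.prod_eq_zero (Finset.mem_univ q) (if_neg hq)

theorem tensorOp_isHermitian {A : Q → Matrix (Fin 2) (Fin 2) ℂ} (h : ∀ q, (A q).IsHermitian) :
    (tensorOp A).IsHermitian := by
  ext s u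
  simp only [tensorOp, conjTranspose_apply, of_apply, star_prod]
  exact Finset.prod_congr rfl fun q _ => (h q).apply _ _

theorem tensorOp_pow_mul_self [DecidableEq Q] {σ : Matrix (Fin 2) (Fin 2) ℂ} (h : σ * σ = 1)
    (m : Q → ℕ) :
    tensorOp (fun q => σ ^ m q) * tensorOp (fun q => σ ^ m q) = 1 := by
  rw [tensorOp_mul, ← tensorOp_one]
  congr 1
  funext q
  rw [← (Commute.refl σ).mul_pow, h, one_pow]

end TensorOp

theorem sigmaX_isHermitian : sigmaX.IsHermitian := by
  ext i j
  fin_cases i <;> fin_cases j <;> simp [sigmaX]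

theorem sigmaZ_isHermitian : sigmaZ.IsHermitian := by
  ext i j
  fin_cases i <;> fin_cases j <;> simp [sigmaZ]

theorem sigmaX_mul_self : sigmaX * sigmaX = 1 := by
  ext i j
  fin_cases i <;> fin_cases j <;> simp [sigmaX]

theorem sigmaZ_mul_self : sigmaZ * sigmaZ = 1 := by
  ext i j
  fin_cases i <;> fin_cases j <;> simp [sigmaZ]

/-- `Fin 2` is read as `ZMod 2`, to which it is definitionally equal, so that a bit flip becomes
addition of the parity of the exponent. -/
theorem sigmaX_pow_apply_add (m : ℕ) (i : ZMod 2) : (sigmaX ^ m) i (i + (m : ZMod 2)) = 1 := by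
  obtain ⟨k, rfl | rfl⟩ := Nat.even_or_odd' m
  · have h : i + ((2 * k : ℕ) : ZMod 2) = i := by
      rw [(ZMod.natCast_eq_zero_iff_even).2 (even_two_mul k), add_zero]
    rw [h, pow_mul, sq, sigmaX_mul_self, one_pow]
    exact one_apply_eq _
  · have h : i + ((2 * k + 1 : ℕ) : ZMod 2) = i + 1 := by
      rw [(ZMod.natCast_eq_one_iff_odd).2 (odd_two_mul_add_one k)]
    rw [h, pow_succ, pow_mul, sq, sigmaX_mul_self, one_pow, one_mul]
    revert i
    intro i _
    fin_cases i <;> rfl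

theorem sigmaX_pow_apply_ne {m : ℕ} {i j : ZMod 2} (hj : j ≠ i + (m : ZMod 2)) :
    (sigmaX ^ m) i j = 0 := by
  obtain ⟨k, rfl | rfl⟩ := Nat.even_or_odd' m
  · have h : i + ((2 * k : ℕ) : ZMod 2) = i := by
      rw [(ZMod.natCast_eq_zero_iff_even).2 (even_two_mul k), add_zero]
    rw [h] at hj
    rw [pow_mul, sq, sigmaX_mul_self, one_pow]
    exact one_apply_ne hj.symm
  · have h : i + ((2 * k + 1 : ℕ) : ZMod 2) = i + 1 := by
      rw [(ZMod.natCast_eq_one_iff_odd).2 (odd_two_mul_add_one k)]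
    rw [h] at hj
    rw [pow_succ, pow_mul, sq, sigmaX_mul_self, one_pow, one_mul]
    revert i j
    intro i j hj _
    fin_cases i <;> fin_cases j <;> first | rfl | exact absurd rfl hj

/-- The sign character of `ZMod 2`. -/
def signChar (a : ZMod 2) : ℂ := if a = 0 then 1 else -1

theorem signChar_zero : signChar 0 = 1 := if_pos rfl

theorem signChar_one : signChar 1 = -1 := if_neg one_ne_zero

theorem signChar_add (a b : ZMod 2) : signChar (a + b) = signChar a * signChar b := by
  have h : ∀ a : ZMod 2, a = 0 ∨ a = 1 := by decide
  have h2 : (1 + 1 : ZMod 2) = 0 := rfl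
  obtain rfl | rfl := h a <;> obtain rfl | rfl := h b <;>
    simp [signChar_zero, signChar_one, h2]

theorem signChar_sum {Q : Type*} (t : Finset Q) (f : Q → ZMod 2) :
    signChar (∑ q ∈ t, f q) = ∏ q ∈ t, signChar (f q) := by
  classical
  induction t using Finset.induction_on with
  | empty => simp [signChar_zero]
  | insert q t hq ih => rw [Finset.sum_insert hq, Finset.prod_insert hq, signChar_add, ih]

theorem sigmaZ_pow_apply_self (m : ℕ) (i : ZMod 2) :
    (sigmaZ ^ m) i i = signChar ((m : ZMod 2) * i) := by
  obtain ⟨k, rfl | rfl⟩ := Nat.even_or_odd' m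
  · rw [(ZMod.natCast_eq_zero_iff_even).2 (even_two_mul k), zero_mul, signChar_zero,
      pow_mul, sq, sigmaZ_mul_self, one_pow]
    exact one_apply_eq _
  · rw [(ZMod.natCast_eq_one_iff_odd).2 (odd_two_mul_add_one k), one_mul, pow_succ, pow_mul, sq,
      sigmaZ_mul_self, one_pow, one_mul]
    revert i
    intro i
    fin_cases i
    · exact signChar_zero.symm
    · exact signChar_one.symm

theorem sigmaZ_pow_apply_ne (m : ℕ) {i j : Fin 2} (h : i ≠ j) : (sigmaZ ^ m) i j = 0 := by
  obtain ⟨k, rfl | rfl⟩ := Nat.even_or_odd' m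
  · rw [pow_mul, sq, sigmaZ_mul_self, one_pow]
    exact one_apply_ne h
  · rw [pow_succ, pow_mul, sq, sigmaZ_mul_self, one_pow, one_mul]
    revert i j
    intro i j h
    fin_cases i <;> fin_cases j <;> first | rfl | exact absurd rfl h

/-! ### Pauli strings acting on functions of bit strings -/

section PauliStrings

variable {Q : Type*} [Fintype Q] [DecidableEq Q]

theorem tensorOp_sigmaX_mulVec (m : Q → ℕ) (ψ : (Q → ZMod 2) → ℂ) (s : Q → ZMod 2) :
    (tensorOp (fun q => sigmaX ^ m q) *ᵥ ψ) s = ψ (s + fun q => (m q : ZMod 2)) := by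
  refine (Finset.sum_eq_single (s + fun q => (m q : ZMod 2)) ?_ ?_).trans ?_
  · intro t _ ht
    obtain ⟨q, hq⟩ := Function.ne_iff.1 ht
    refine mul_eq_zero_of_left (Finset.prod_eq_zero (Finset.mem_univ q) ?_) _
    exact sigmaX_pow_apply_ne hq
  · intro h
    exact absurd (Finset.mem_univ _) h
  · refine (congrArg (· * _) (Finset.prod_eq_one fun q _ => ?_)).trans (one_mul _)
    exact sigmaX_pow_apply_add _ _

theorem tensorOp_sigmaZ_mulVec (m : Q → ℕ) (ψ : (Q → ZMod 2) → ℂ) (s : Q → ZMod 2) :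
    (tensorOp (fun q => sigmaZ ^ m q) *ᵥ ψ) s =
      signChar (∑ q, (m q : ZMod 2) * s q) * ψ s := by
  refine (Finset.sum_eq_single s ?_ ?_).trans ?_
  · intro t _ ht
    obtain ⟨q, hq⟩ := Function.ne_iff.1 ht
    refine mul_eq_zero_of_left (Finset.prod_eq_zero (Finset.mem_univ q) ?_) _
    exact sigmaZ_pow_apply_ne _ hq.symm
  · intro h
    exact absurd (Finset.mem_univ _) h
  · rw [signChar_sum]
    exact congrArg (· * ψ s) (Finset.prod_congr rfl fun q _ => sigmaZ_pow_apply_self _ _)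

theorem tensorOp_sigmaZ_mulVec_eq_self_iff (m : Q → ℕ) (ψ : (Q → ZMod 2) → ℂ) :
    tensorOp (fun q => sigmaZ ^ m q) *ᵥ ψ = ψ ↔
      ∀ s : Q → ZMod 2, ∑ q, (m q : ZMod 2) * s q ≠ 0 → ψ s = 0 := by
  constructor
  · intro h s hs
    have h1 := (tensorOp_sigmaZ_mulVec m ψ s).symm.trans (congrFun h s)
    rw [signChar, if_neg hs] at h1
    linear_combination (-1 / 2 : ℂ) * h1
  · intro h
    funext s
    refine (tensorOp_sigmaZ_mulVec m ψ s).trans ?_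
    by_cases hs : ∑ q, (m q : ZMod 2) * (show ZMod 2 from s q) = 0
    · rw [hs, signChar_zero, one_mul]
    · rw [h s hs]
      exact mul_zero _

theorem tensorOp_sigmaX_mulVec_eq_self_iff (m : Q → ℕ) (ψ : (Q → ZMod 2) → ℂ) :
    tensorOp (fun q => sigmaX ^ m q) *ᵥ ψ = ψ ↔
      ∀ s : Q → ZMod 2, ψ (s + fun q => (m q : ZMod 2)) = ψ s :=
  ⟨fun h s => (tensorOp_sigmaX_mulVec m ψ s).symm.trans (congrFun h s),
    fun h => funext fun s => (tensorOp_sigmaX_mulVec m ψ s).trans (h s)⟩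

end PauliStrings

/-! ### Functions supported on a subspace and invariant under a smaller one -/

section CodeSpace

variable {V : Type*} [AddCommGroup V] [Module (ZMod 2) V]

open Classical in
/-- Extension by zero of a function on `K / B`, for subspaces `B` and `K`, to the whole space. -/
noncomputable def extendQuotient (K : Submodule (ZMod 2) V) (B : Submodule (ZMod 2) V) :
    ((K ⧸ B.comap K.subtype) → ℂ) →ₗ[ℂ] (V → ℂ) where
  toFun f s := if h : s ∈ K then f (Submodule.Quotient.mk ⟨s, h⟩) else 0
  map_add' f g := by
    funext s
    by_cases h : s ∈ K <;> simp [h]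
  map_smul' c f := by
    funext s
    by_cases h : s ∈ K <;> simp [h]

theorem extendQuotient_injective (K B : Submodule (ZMod 2) V) :
    Function.Injective (extendQuotient K B) := by
  intro f g h
  funext x
  obtain ⟨⟨s, hs⟩, rfl⟩ := Submodule.Quotient.mk_surjective _ x
  have h1 := congrFun h s
  simpa [extendQuotient, hs] using h1

theorem mem_range_extendQuotient_iff {K B : Submodule (ZMod 2) V} (hBK : B ≤ K) (ψ : V → ℂ) :
    ψ ∈ LinearMap.range (extendQuotient K B) ↔
      (∀ s, s ∉ K → ψ s = 0) ∧ ∀ b ∈ B, ∀ s, ψ (s + b) = ψ s := by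
  constructor
  · rintro ⟨f, rfl⟩
    refine ⟨fun s hs => dif_neg hs, fun b hb s => ?_⟩
    by_cases hs : s ∈ K
    · have hsb : s + b ∈ K := K.add_mem hs (hBK hb)
      simp only [extendQuotient, LinearMap.coe_mk, AddHom.coe_mk, dif_pos hs, dif_pos hsb]
      congr 1
      rw [Submodule.Quotient.eq, Submodule.mem_comap]
      simpa using hb
    · have hsb : s + b ∉ K := fun h => hs ((K.add_mem_iff_left (hBK hb)).1 h)
      simp only [extendQuotient, LinearMap.coe_mk, AddHom.coe_mk, dif_neg hs, dif_neg hsb]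
  · rintro ⟨h0, hB⟩
    refine ⟨fun x => Quotient.liftOn' x (fun s => ψ s) ?_, ?_⟩
    · intro s t hst
      rw [Submodule.quotientRel_def, Submodule.mem_comap] at hst
      have := hB _ hst t
      simpa using this
    · funext s
      by_cases hs : s ∈ K
      · simp only [extendQuotient, LinearMap.coe_mk, AddHom.coe_mk, dif_pos hs]
        rfl
      · simp only [extendQuotient, LinearMap.coe_mk, AddHom.coe_mk, dif_neg hs, h0 s hs]

theorem finrank_range_extendQuotient [Finite V] {K B : Submodule (ZMod 2) V} (hBK : B ≤ K) :
    Module.finrank ℂ (LinearMap.range (extendQuotient K B)) =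
      2 ^ (Module.finrank (ZMod 2) K - Module.finrank (ZMod 2) B) := by
  classical
  have : Module.Finite (ZMod 2) V := Module.Finite.of_finite
  have : Finite (K ⧸ B.comap K.subtype) := Quotient.finite _
  have := Fintype.ofFinite (K ⧸ B.comap K.subtype)
  rw [LinearMap.finrank_range_of_inj (extendQuotient_injective K B),
    Module.finrank_fintype_fun_eq_card, Module.card_eq_pow_finrank (K := ZMod 2), ZMod.card]
  congr 1
  rw [← (Submodule.comapSubtypeEquivOfLe hBK).finrank_eq]
  have := Submodule.finrank_quotient_add_finrank (B.comap K.subtype)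
  omega

end CodeSpace

end CubicCode

namespace CubicCode

open Matrix

/-! ### Degeneracy of a CSS Hamiltonian -/

section CSS

variable {Q I : Type*} [Fintype Q] [DecidableEq Q] [Fintype I] [DecidableEq I]

/-- The reduction modulo `2` of a family of exponent vectors. -/
def modTwo {I Q : Type*} (a : I → Q → ℕ) : Matrix I Q (ZMod 2) := of fun i q => (a i q : ZMod 2)

/-- The `Z`-type operators with exponents `a` followed by the `X`-type operators with
exponents `b`. -/
def cssTerm (a b : I → Q → ℕ) : I ⊕ I → Matrix (Q → Fin 2) (Q → Fin 2) ℂ :=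
  Sum.elim (fun i => tensorOp fun q => sigmaZ ^ a i q) (fun i => tensorOp fun q => sigmaX ^ b i q)

theorem fixedSpace_cssTerm {a b : I → Q → ℕ} (hab : modTwo a * (modTwo b)ᵀ = 0) :
    fixedSpace (cssTerm a b) = LinearMap.range
      (extendQuotient (LinearMap.ker (modTwo a).mulVecLin)
        (LinearMap.range (modTwo b)ᵀ.mulVecLin)) := by
  have hBK : LinearMap.range (modTwo b)ᵀ.mulVecLin ≤ LinearMap.ker (modTwo a).mulVecLin := by
    rintro _ ⟨x, rfl⟩
    rw [LinearMap.mem_ker, mulVecLin_apply, mulVecLin_apply, mulVec_mulVec, hab, zero_mulVec]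
  ext ψ
  refine Iff.trans ?_ (mem_range_extendQuotient_iff hBK ψ).symm
  rw [mem_fixedSpace, Sum.forall]
  refine and_congr ?_ ?_
  · refine (forall_congr' fun i => tensorOp_sigmaZ_mulVec_eq_self_iff (a i) ψ).trans ?_
    have hK : ∀ s, s ∉ LinearMap.ker (modTwo a).mulVecLin ↔
        ∃ i, ∑ q, (a i q : ZMod 2) * s q ≠ 0 := by
      intro s
      rw [LinearMap.mem_ker, ← ne_eq, Function.ne_iff]
      rfl
    constructor
    · intro h s hs
      obtain ⟨i, hi⟩ := (hK s).1 hs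
      exact h i s hi
    · intro h i s hs
      exact h s ((hK s).2 ⟨i, hs⟩)
  · refine (forall_congr' fun i => tensorOp_sigmaX_mulVec_eq_self_iff (b i) ψ).trans ?_
    constructor
    · intro h
      have hrange : LinearMap.range (modTwo b)ᵀ.mulVecLin =
          Submodule.span (ZMod 2) (Set.range fun i q => (b i q : ZMod 2)) :=
        range_mulVecLin _
      -- Invariance under the rows of `b` extends to their span, because translations compose.
      intro x hx
      rw [hrange] at hx
      induction hx using Submodule.span_induction with
      | mem x hx =>
        obtain ⟨i, rfl⟩ := hx
        exact h i
      | zero => intro s; rw [add_zero]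
      | add x y _ _ hx hy => intro s; rw [← add_assoc, hy, hx]
      | smul c x _ hx =>
        intro s
        have hc : ∀ c : ZMod 2, c = 0 ∨ c = 1 := by decide
        obtain rfl | rfl := hc c
        · rw [zero_smul, add_zero]
        · rw [one_smul, hx]
    · intro h i s
      refine h _ ⟨Pi.single i 1, ?_⟩ s
      rw [mulVecLin_apply, mulVec_single_one]
      rfl

theorem finrank_ker_add_rank_transpose {m n : Type*} [Fintype m] [Fintype n]
    [DecidableEq m] [DecidableEq n]
    {F : Type*} [Field F] (A : Matrix m n F) :
    Module.finrank F (LinearMap.ker Aᵀ.mulVecLin) + A.rank = Fintype.card m := by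
  rw [← rank_transpose A, add_comm, rank, LinearMap.finrank_range_add_finrank_ker,
    Module.finrank_fintype_fun_eq_card]

/-- The exponent is `dim ker a - rank b = |Q| - rank a - rank b`. With `|Q| = 2 |I|` it splits into
the two coranks `|I| - rank a` and `|I| - rank b`. -/
theorem hasGroundStateDegeneracy_css {a b : I → Q → ℕ} (hab : modTwo a * (modTwo b)ᵀ = 0)
    (hcard : Fintype.card Q = 2 * Fintype.card I) :
    HasGroundStateDegeneracy
      (-∑ i, ((tensorOp fun q => sigmaZ ^ a i q) + tensorOp fun q => sigmaX ^ b i q))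
      (2 ^ (Module.finrank (ZMod 2) (LinearMap.ker (modTwo a)ᵀ.mulVecLin) +
        Module.finrank (ZMod 2) (LinearMap.ker (modTwo b)ᵀ.mulVecLin))) := by
  have hBK : LinearMap.range (modTwo b)ᵀ.mulVecLin ≤ LinearMap.ker (modTwo a).mulVecLin := by
    rintro _ ⟨x, rfl⟩
    rw [LinearMap.mem_ker, mulVecLin_apply, mulVecLin_apply, mulVec_mulVec, hab, zero_mulVec]
  have hdim : Module.finrank ℂ (fixedSpace (cssTerm a b)) =
      2 ^ (Module.finrank (ZMod 2) (LinearMap.ker (modTwo a)ᵀ.mulVecLin) +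
        Module.finrank (ZMod 2) (LinearMap.ker (modTwo b)ᵀ.mulVecLin)) := by
    rw [fixedSpace_cssTerm hab]
    refine (finrank_range_extendQuotient hBK).trans ?_
    congr 1
    have h1 := finrank_ker_add_rank_transpose (modTwo a)
    have h2 := finrank_ker_add_rank_transpose (modTwo b)
    have h3 := finrank_ker_add_rank_transpose (modTwo a)ᵀ
    have h4 := Submodule.finrank_mono hBK
    rw [transpose_transpose, rank_transpose] at h3
    have h5 := rank_transpose (modTwo b)
    rw [rank] at h5
    omega
  have hsum : (-∑ i, ((tensorOp fun q => sigmaZ ^ a i q) + tensorOp fun q => sigmaX ^ b i q)) =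
      -∑ i, cssTerm a b i := by
    rw [Fintype.sum_sum_type, Finset.sum_add_distrib]
    rfl
  rw [hsum, ← hdim]
  refine hasGroundStateDegeneracy_neg_sum _ ?_ ?_ (by rw [hdim]; positivity)
  · rintro (i | i)
    · exact tensorOp_isHermitian fun q => sigmaZ_isHermitian.pow _
    · exact tensorOp_isHermitian fun q => sigmaX_isHermitian.pow _
  · rintro (i | i)
    · exact tensorOp_pow_mul_self sigmaZ_mul_self _
    · exact tensorOp_pow_mul_self sigmaX_mul_self _

end CSS

/-! ### Relations among the cubic code terms -/

section Lattice

variable {L : ℕ}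

/-- The displacement of a corner, as a lattice vector. -/
def corner (L : ℕ) (c : ℕ × ℕ × ℕ) : Site L := (c.1, c.2.1, c.2.2)

/-- Functions on the lattice, with values in `M`, whose sum over every translate of the two
patterns of corners of the `X`-type interaction term vanishes. -/
def patternKernel (L : ℕ) (R M : Type*) [Semiring R] [AddCommGroup M] [Module R M] :
    Submodule R (Site L → M) where
  carrier := {φ | ∀ (j : Fin 2) (u : Site L), ∑ c ∈ xCorners j, φ (u + corner L c) = 0}
  add_mem' ha hb j u := by
    simp only [Pi.add_apply, Finset.sum_add_distrib, ha j u, hb j u, add_zero]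
  zero_mem' j u := by simp
  smul_mem' r φ h j u := by
    simp only [Pi.smul_apply, ← Finset.smul_sum, h j u, smul_zero]

theorem mem_patternKernel {R M : Type*} [Semiring R] [AddCommGroup M] [Module R M]
    {φ : Site L → M} : φ ∈ patternKernel L R M ↔
      ∀ (j : Fin 2) (u : Site L), ∑ c ∈ xCorners j, φ (u + corner L c) = 0 := Iff.rfl

variable [NeZero L]

theorem modTwo_multiplicity_transpose_mulVec (K : Fin 2 → Finset (ℕ × ℕ × ℕ))
    (φ : Site L → ZMod 2) (q : Qubit L) :
    ((modTwo (multiplicity K))ᵀ *ᵥ φ) q = ∑ c ∈ K q.2, φ (q.1 - corner L c) := by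
  have h : ∀ v, (modTwo (multiplicity K))ᵀ q v * φ v =
      ∑ c ∈ K q.2, if v = q.1 - corner L c then φ v else 0 := by
    intro v
    rw [transpose_apply, modTwo, of_apply, multiplicity, Finset.card_filter, Nat.cast_sum,
      Finset.sum_mul]
    refine Finset.sum_congr rfl fun c _ => ?_
    have hiff : cornerSite v c = q.1 ↔ v = q.1 - corner L c := by
      rw [eq_sub_iff_add_eq]
      rfl
    by_cases hc : cornerSite v c = q.1
    · rw [if_pos hc, if_pos (hiff.1 hc), Nat.cast_one, one_mul]
    · rw [if_neg hc, if_neg (mt hiff.2 hc), Nat.cast_zero, zero_mul]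
  rw [mulVec, dotProduct, Finset.sum_congr rfl fun v _ => h v, Finset.sum_comm]
  refine Finset.sum_congr rfl fun c _ => ?_
  rw [Finset.sum_ite_eq' Finset.univ, if_pos (Finset.mem_univ _)]

theorem finrank_ker_xCorners :
    Module.finrank (ZMod 2)
        (LinearMap.ker (modTwo (multiplicity (L := L) xCorners))ᵀ.mulVecLin) =
      Module.finrank (ZMod 2) (patternKernel L (ZMod 2) (ZMod 2)) := by
  let e : (Site L → ZMod 2) ≃ₗ[ZMod 2] (Site L → ZMod 2) :=
    LinearEquiv.funCongrLeft (ZMod 2) (ZMod 2) (Equiv.neg (Site L))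
  have : LinearMap.ker (modTwo (multiplicity (L := L) xCorners))ᵀ.mulVecLin =
      (patternKernel L (ZMod 2) (ZMod 2)).comap e.toLinearMap := by
    ext φ
    rw [LinearMap.mem_ker, Submodule.mem_comap, mem_patternKernel, funext_iff, Prod.forall,
      forall_comm]
    refine forall_congr' fun j => ?_
    rw [← (Equiv.neg (Site L)).forall_congr_right]
    refine forall_congr' fun u => ?_
    rw [mulVecLin_apply, modTwo_multiplicity_transpose_mulVec]
    have : ∀ c, e φ (u + corner L c) = φ (-u - corner L c) := fun c => by
      change φ (-(u + corner L c)) = _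
      rw [neg_add']
    simp only [LinearEquiv.coe_coe, this, Equiv.neg_apply, Pi.zero_apply]
  rw [this, Submodule.comap_equiv_eq_map_symm]
  exact LinearEquiv.finrank_map_eq e.symm _

/-- The `Z` pattern on one qubit is `xyz` times the inverse of the `X` pattern on the other qubit.
Hence the swap of the two qubits and the translation by `(1, 1, 1)`. -/
theorem finrank_ker_zCorners :
    Module.finrank (ZMod 2)
        (LinearMap.ker (modTwo (multiplicity (L := L) zCorners))ᵀ.mulVecLin) =
      Module.finrank (ZMod 2) (patternKernel L (ZMod 2) (ZMod 2)) := by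
  have : LinearMap.ker (modTwo (multiplicity (L := L) zCorners))ᵀ.mulVecLin =
      patternKernel L (ZMod 2) (ZMod 2) := by
    ext φ
    rw [LinearMap.mem_ker, mem_patternKernel, funext_iff, Prod.forall, forall_comm]
    rw [← (Equiv.swap (0 : Fin 2) 1).forall_congr_right]
    refine forall_congr' fun j => ?_
    rw [← (Equiv.addRight (corner L (1, 1, 1))).forall_congr_right]
    refine forall_congr' fun u => ?_
    rw [mulVecLin_apply, modTwo_multiplicity_transpose_mulVec]
    obtain ⟨x, y, z⟩ := u
    fin_cases j <;> simp [zCorners, xCorners, corner, add_comm, add_left_comm] <;>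
      exact Eq.congr (by ring) rfl
  rw [this]

theorem modTwo_multiplicity_mulVec (K : Fin 2 → Finset (ℕ × ℕ × ℕ))
    (ψ : Qubit L → ZMod 2) (v : Site L) :
    ((modTwo (multiplicity K)) *ᵥ ψ) v = ∑ j, ∑ c ∈ K j, ψ (v + corner L c, j) := by
  have h : ∀ q : Qubit L, modTwo (multiplicity K) v q * ψ q =
      ∑ c ∈ K q.2, if q.1 = v + corner L c then ψ q else 0 := by
    intro q
    rw [modTwo, of_apply, multiplicity, Finset.card_filter, Nat.cast_sum, Finset.sum_mul]
    refine Finset.sum_congr rfl fun c _ => ?_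
    have hiff : cornerSite v c = q.1 ↔ q.1 = v + corner L c := eq_comm
    by_cases hc : cornerSite v c = q.1
    · rw [if_pos hc, if_pos (hiff.1 hc), Nat.cast_one, one_mul]
    · rw [if_neg hc, if_neg (mt hiff.2 hc), Nat.cast_zero, zero_mul]
  rw [mulVec, dotProduct, Finset.sum_congr rfl fun q _ => h q, Fintype.sum_prod_type_right]
  refine Finset.sum_congr rfl fun j _ => ?_
  refine (Finset.sum_comm (s := Finset.univ) (t := K j)
    (f := fun (u : Site L) c => if u = v + corner L c then ψ (u, j) else 0)).trans ?_
  refine Finset.sum_congr rfl fun c _ => ?_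
  rw [Finset.sum_ite_eq' Finset.univ, if_pos (Finset.mem_univ _)]

omit [NeZero L] in
-- This is the commutation of the `Z` and `X` terms. By the inversion symmetry of the patterns the
-- contributions `j = 0` and `j = 1` are the same polynomial, so every coefficient is even;
-- `ring_nf` leaves only `2` and `6`.
theorem sum_zCorners_xCorners (f : Site L → ZMod 2) (v : Site L) :
    ∑ j, ∑ c ∈ zCorners j, ∑ d ∈ xCorners j, f (v + corner L c - corner L d) = 0 := by
  obtain ⟨x, y, z⟩ := v
  have h2 : (2 : ZMod 2) = 0 := rfl
  have h6 : (6 : ZMod 2) = 0 := rfl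
  simp [Fin.sum_univ_two, zCorners, xCorners, corner]
  ring_nf
  simp [h2, h6]

theorem modTwo_zCorners_mul_xCorners :
    modTwo (multiplicity (L := L) zCorners) * (modTwo (multiplicity (L := L) xCorners))ᵀ = 0 := by
  refine ext_of_mulVec_single fun w => ?_
  rw [← mulVec_mulVec, zero_mulVec]
  funext v
  rw [modTwo_multiplicity_mulVec]
  simp only [modTwo_multiplicity_transpose_mulVec]
  exact sum_zCorners_xCorners _ v

theorem hasGroundStateDegeneracy_hamiltonian (L : ℕ) [NeZero L] :
    HasGroundStateDegeneracy (hamiltonian L)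
      (2 ^ (2 * Module.finrank (ZMod 2) (patternKernel L (ZMod 2) (ZMod 2)))) := by
  have h := hasGroundStateDegeneracy_css (modTwo_zCorners_mul_xCorners (L := L))
    (by simp [mul_comm])
  rw [finrank_ker_xCorners, finrank_ker_zCorners, ← two_mul] at h
  exact h

end Lattice

end CubicCode

namespace CubicCode

open Polynomial

/-! ### Extension of scalars for the solution space -/

section BaseChange

/-- Functions with values in a free module decompose coordinatewise. -/
noncomputable def patternKernelPi (L : ℕ) {R M : Type*} [CommRing R] [AddCommGroup M] [Module R M]
    {n : ℕ} (e : M ≃ₗ[R] (Fin n → R)) :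
    patternKernel L R M ≃ₗ[R] (Fin n → patternKernel L R R) where
  toFun φ i := ⟨fun u => e (φ.1 u) i, fun j u => by
    rw [← Finset.sum_apply, ← map_sum, φ.2 j u, map_zero, Pi.zero_apply]⟩
  map_add' φ ψ := by
    ext i u
    simp
  map_smul' r φ := by
    ext i u
    simp
  invFun ψ := ⟨fun u => e.symm fun i => (ψ i).1 u, fun j u => by
    rw [← map_sum, ← map_zero e.symm]
    congr 1
    funext i
    rw [Finset.sum_apply]
    exact (ψ i).2 j u⟩
  left_inv φ := by
    ext u
    simp
  right_inv ψ := by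
    ext i u
    simp

/-- The `F`-valued solutions are counted over `K` in two ways: through the tower `K ⊆ F`, and
through coordinates in a `K`-basis of `F`. Both counts carry the factor `[F : K]`. -/
theorem finrank_patternKernel_of_algebra (L : ℕ) [NeZero L] (K F : Type*) [Field K] [Field F]
    [Algebra K F] [FiniteDimensional K F] :
    Module.finrank F (patternKernel L F F) = Module.finrank K (patternKernel L K K) := by
  have h1 := (patternKernelPi L (Module.finBasis K F).equivFun).finrank_eq
  rw [Module.finrank_pi_fintype, Finset.sum_const, Finset.card_univ, Fintype.card_fin,
    smul_eq_mul] at h1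
  have h2 := Module.finrank_mul_finrank K F (patternKernel L F F)
  have h3 : Module.finrank K (patternKernel L F F) = Module.finrank K (patternKernel L K F) :=
    rfl
  exact Nat.eq_of_mul_eq_mul_left Module.finrank_pos (h2.trans (h3.trans h1))

end BaseChange

/-! ### Duality with a quotient of the group algebra -/

section GroupAlgebra

open AddMonoidAlgebra

variable (L : ℕ) (F : Type*) [Field F]

/-- The group algebra of the lattice. -/
abbrev LatticeAlgebra : Type _ := AddMonoidAlgebra F (Site L)

/-- The pattern polynomials of the `X`-type interaction term, in the group algebra. -/
noncomputable def patternPoly (j : Fin 2) : LatticeAlgebra L F :=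
  ∑ c ∈ xCorners j, single (corner L c) 1

/-- The ideal generated by the pattern polynomials. -/
noncomputable def patternIdeal : Ideal (LatticeAlgebra L F) :=
  Ideal.span {patternPoly L F 0, patternPoly L F 1}

/-- The quotient of the group algebra by the pattern polynomials. -/
abbrev PatternQuotient : Type _ := LatticeAlgebra L F ⧸ patternIdeal L F

/-- Functions on the lattice are the linear functionals on the group algebra. -/
noncomputable def functionalEquiv : (Site L → F) ≃ₗ[F] Module.Dual F (LatticeAlgebra L F) :=
  (Finsupp.llift F F F (Site L)).trans
    ((coeffLinearEquiv F).symm.congrLeft F F)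

theorem functionalEquiv_single (φ : Site L → F) (u : Site L) (r : F) :
    functionalEquiv L F φ (single u r) = r * φ u := by
  change Finsupp.lift F F (Site L) φ (Finsupp.single u r) = _
  rw [Finsupp.lift_apply, Finsupp.sum_single_index (h := fun u r => r • φ u) (zero_smul _ _),
    smul_eq_mul]

theorem functionalEquiv_mul_patternPoly (φ : Site L → F) (u : Site L) (r : F) (j : Fin 2) :
    functionalEquiv L F φ (single u r * patternPoly L F j) =
      r * ∑ c ∈ xCorners j, φ (u + corner L c) := by
  simp only [patternPoly, Finset.mul_sum, map_sum, single_mul_single, mul_one,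
    functionalEquiv_single]

/-- A functional kills the ideal exactly when it kills all monomial multiples of the two generators,
which are the translated pattern sums. -/
theorem comap_dualAnnihilator_patternIdeal :
    ((patternIdeal L F).restrictScalars F).dualAnnihilator.comap
      (functionalEquiv L F).toLinearMap = patternKernel L F F := by
  ext φ
  rw [Submodule.mem_comap, Submodule.mem_dualAnnihilator, mem_patternKernel]
  constructor
  · intro h j u
    have hj : patternPoly L F j ∈ patternIdeal L F := by
      refine Ideal.subset_span ?_
      fin_cases j <;> simp
    have := h _ ((patternIdeal L F).mul_mem_left (single u 1) hj)
    rw [LinearEquiv.coe_coe, functionalEquiv_mul_patternPoly, one_mul] at this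
    exact this
  · intro h w hw
    have key : ∀ (j : Fin 2) (a : LatticeAlgebra L F),
        functionalEquiv L F φ (a * patternPoly L F j) = 0 := by
      intro j a
      induction a using AddMonoidAlgebra.induction_linear with
      | zero => rw [zero_mul, map_zero]
      | add a b ha hb => rw [add_mul, map_add, ha, hb, add_zero]
      | single u r => rw [functionalEquiv_mul_patternPoly, h, mul_zero]
    obtain ⟨a, b, rfl⟩ := Ideal.mem_span_pair.1 hw
    rw [LinearEquiv.coe_coe, map_add, key, key, add_zero]

theorem finrank_patternQuotient [NeZero L] :
    Module.finrank F (PatternQuotient L F) = Module.finrank F (patternKernel L F F) := by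
  have : FiniteDimensional F (LatticeAlgebra L F) :=
    Module.Finite.equiv (coeffLinearEquiv F).symm
  rw [← comap_dualAnnihilator_patternIdeal, Submodule.comap_equiv_eq_map_symm,
    LinearEquiv.finrank_map_eq, ← (Submodule.dualQuotEquivDualAnnihilator _).finrank_eq,
    Subspace.dual_finrank_eq]
  rfl

variable {L F}

theorem single_corner (i j k : ℕ) :
    (single (corner L (i, j, k)) 1 : LatticeAlgebra L F) =
      single (corner L (1, 0, 0)) 1 ^ i * single (corner L (0, 1, 0)) 1 ^ j *
        single (corner L (0, 0, 1)) 1 ^ k := by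
  simp [single_pow, single_mul_single, corner]

theorem single_corner_pow_self (c : ℕ × ℕ × ℕ) :
    (single (corner L c) 1 : LatticeAlgebra L F) ^ L = 1 := by
  rw [single_pow, one_pow, one_def]
  congr 1
  simp [corner]

/-- The algebra homomorphism from the group algebra defined by three commuting elements whose
`L`-th power is `1`. -/
noncomputable def latticeLift [NeZero L] {B : Type*} [CommRing B] [Algebra F B] (a b c : B)
    (ha : a ^ L = 1) (hb : b ^ L = 1) (hc : c ^ L = 1) : LatticeAlgebra L F →ₐ[F] B :=
  AddMonoidAlgebra.lift F B (Site L)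
    { toFun := fun s => a ^ s.toAdd.1.val * b ^ s.toAdd.2.1.val * c ^ s.toAdd.2.2.val
      map_one' := by simp
      map_mul' := fun s t => by
        simp only [toAdd_mul, Prod.fst_add, Prod.snd_add, ZMod.val_add, ← pow_eq_pow_mod _ ha,
          ← pow_eq_pow_mod _ hb, ← pow_eq_pow_mod _ hc, pow_add]
        ring }

theorem latticeLift_corner [NeZero L] {B : Type*} [CommRing B] [Algebra F B] {a b c : B}
    (ha : a ^ L = 1) (hb : b ^ L = 1) (hc : c ^ L = 1) (i j k : ℕ) :
    latticeLift (F := F) a b c ha hb hc (single (corner L (i, j, k)) 1) =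
      a ^ i * b ^ j * c ^ k := by
  rw [latticeLift, lift_single, one_smul]
  simp only [corner, MonoidHom.coe_mk, OneHom.coe_mk, toAdd_ofAdd, ZMod.val_natCast,
    ← pow_eq_pow_mod _ ha, ← pow_eq_pow_mod _ hb, ← pow_eq_pow_mod _ hc]

/-- The image in the quotient algebra of the translation in the first direction. -/
noncomputable def coordX : PatternQuotient L F :=
  Ideal.Quotient.mk _ (single (corner L (1, 0, 0)) 1)

/-- The image in the quotient algebra of the translation in the second direction. -/
noncomputable def coordY : PatternQuotient L F :=
  Ideal.Quotient.mk _ (single (corner L (0, 1, 0)) 1)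

/-- The image in the quotient algebra of the translation in the third direction. -/
noncomputable def coordZ : PatternQuotient L F :=
  Ideal.Quotient.mk _ (single (corner L (0, 0, 1)) 1)

theorem mk_single_corner (i j k : ℕ) :
    Ideal.Quotient.mk (patternIdeal L F) (single (corner L (i, j, k)) 1) =
      (coordX : PatternQuotient L F) ^ i * (coordY : PatternQuotient L F) ^ j *
        (coordZ : PatternQuotient L F) ^ k := by
  rw [single_corner, map_mul, map_mul, map_pow, map_pow, map_pow]
  rfl

theorem coordX_pow : (coordX : PatternQuotient L F) ^ L = 1 := by
  rw [coordX, ← map_pow, single_corner_pow_self, map_one]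

theorem coordY_pow : (coordY : PatternQuotient L F) ^ L = 1 := by
  rw [coordY, ← map_pow, single_corner_pow_self, map_one]

theorem coordZ_pow : (coordZ : PatternQuotient L F) ^ L = 1 := by
  rw [coordZ, ← map_pow, single_corner_pow_self, map_one]

theorem mk_patternPoly (j : Fin 2) :
    Ideal.Quotient.mk (patternIdeal L F) (patternPoly L F j) = 0 := by
  rw [Ideal.Quotient.eq_zero_iff_mem]
  refine Ideal.subset_span ?_
  fin_cases j <;> simp

theorem coord_relation_quadratic : (1 : PatternQuotient L F) + coordX * coordY + coordY * coordZ +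
    coordZ * coordX = 0 := by
  have h := mk_patternPoly (L := L) (F := F) 0
  simp only [patternPoly, map_sum, xCorners] at h
  simp [mk_single_corner] at h
  rw [← h]
  ring

theorem coord_relation_linear : (1 : PatternQuotient L F) + coordX + coordY + coordZ = 0 := by
  have h := mk_patternPoly (L := L) (F := F) 1
  simp only [patternPoly, map_sum, xCorners] at h
  simp [mk_single_corner] at h
  rw [← h]
  ring

theorem adjoin_coord [NeZero L] (S : Subalgebra F (PatternQuotient L F)) (hx : coordX ∈ S)
    (hy : coordY ∈ S) (hz : coordZ ∈ S) : S = ⊤ := by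
  rw [eq_top_iff]
  rintro a -
  obtain ⟨a, rfl⟩ := Ideal.Quotient.mk_surjective a
  induction a using AddMonoidAlgebra.induction_linear with
  | zero => rw [map_zero]; exact S.zero_mem
  | add a b ha hb => rw [map_add]; exact S.add_mem ha hb
  | single u r =>
    have hu : u = corner L (u.1.val, u.2.1.val, u.2.2.val) := by
      simp [corner]
    have h1 : (single u r : LatticeAlgebra L F) = r • single u 1 := by
      rw [smul_single', mul_one]
    rw [h1, ← Ideal.Quotient.mkₐ_eq_mk F, map_smul, Ideal.Quotient.mkₐ_eq_mk, hu,
      mk_single_corner]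
    exact S.smul_mem (S.mul_mem (S.mul_mem (S.pow_mem hx _) (S.pow_mem hy _)) (S.pow_mem hz _)) _

/-- The algebra homomorphism from the quotient algebra defined by three commuting elements whose
`L`-th power is `1` and which satisfy the two pattern relations. -/
theorem exists_patternLift [NeZero L] {B : Type*} [CommRing B] [Algebra F B] (a b c : B)
    (ha : a ^ L = 1) (hb : b ^ L = 1) (hc : c ^ L = 1)
    (h0 : 1 + a * b + b * c + c * a = 0) (h1 : 1 + a + b + c = 0) :
    ∃ f : PatternQuotient L F →ₐ[F] B, f coordX = a ∧ f coordY = b ∧ f coordZ = c := by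
  refine ⟨Ideal.Quotient.liftₐ (patternIdeal L F) (latticeLift a b c ha hb hc) ?_, ?_, ?_, ?_⟩
  · intro w hw
    have e0 : latticeLift (F := F) a b c ha hb hc (patternPoly L F 0) = 0 := by
      simp only [patternPoly, map_sum, xCorners]
      simp [latticeLift_corner]
      rw [← h0]
      ring
    have e1 : latticeLift (F := F) a b c ha hb hc (patternPoly L F 1) = 0 := by
      simp only [patternPoly, map_sum, xCorners]
      simp [latticeLift_corner]
      rw [← h1]
      ring
    obtain ⟨p, q, rfl⟩ := Ideal.mem_span_pair.1 hw
    rw [map_add, map_mul, map_mul, e0, e1, mul_zero, mul_zero, add_zero]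
  · refine (latticeLift_corner ha hb hc 1 0 0).trans ?_
    simp
  · refine (latticeLift_corner ha hb hc 0 1 0).trans ?_
    simp
  · refine (latticeLift_corner ha hb hc 0 0 1).trans ?_
    simp

end GroupAlgebra

end CubicCode

namespace CubicCode

open Polynomial

/-! ### Algebras with a nodal singularity -/

section Node

variable {F A : Type*} [Field F] [CommRing A] [Algebra F A]

theorem aeval_eq_mul_aeval_divX_add (u : A) (p : F[X]) :
    aeval u p = u * aeval u p.divX + algebraMap F A (p.eval 0) := by
  conv_lhs => rw [← divX_mul_X_add p]
  rw [map_add, map_mul, aeval_X, aeval_C, coeff_zero_eq_eval_zero, mul_comm]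

theorem mul_aeval_eq_of_mul_eq_zero {u v : A} (huv : u * v = 0) (p : F[X]) :
    v * aeval u p = v * algebraMap F A (p.eval 0) := by
  rw [aeval_eq_mul_aeval_divX_add u p]
  linear_combination aeval u p.divX * huv

/-- In an algebra generated by `u` and `v` with `u * v = 0`, each element is the sum of a
polynomial in `u` and a polynomial in `v` without constant term. -/
theorem exists_aeval_add_of_adjoin_eq_top {u v : A} (huv : u * v = 0)
    (htop : Algebra.adjoin F {u, v} = ⊤) (a : A) :
    ∃ f h : F[X], a = aeval u f + v * aeval v h := by
  have ha : a ∈ Algebra.adjoin F {u, v} := htop ▸ Algebra.mem_top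
  induction ha using Algebra.adjoin_induction with
  | mem x hx =>
    obtain rfl | rfl := hx
    · exact ⟨X, 0, by simp⟩
    · exact ⟨0, 1, by simp⟩
  | algebraMap r => exact ⟨C r, 0, by simp⟩
  | add x y _ _ hx hy =>
    obtain ⟨f, h, rfl⟩ := hx
    obtain ⟨f', h', rfl⟩ := hy
    exact ⟨f + f', h + h', by simp only [map_add]; ring⟩
  | mul x y _ _ hx hy =>
    obtain ⟨f, h, rfl⟩ := hx
    obtain ⟨f', h', rfl⟩ := hy
    -- A cross term `f(u) * v h'(v)` retains only the constant `f(0)`, since `u v = 0`; the last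
    -- summand is `v² h h'` with one factor `v` taken out.
    refine ⟨f * f', C (f.eval 0) * h' + C (f'.eval 0) * h + X * h * h', ?_⟩
    have h1 := mul_aeval_eq_of_mul_eq_zero huv f
    have h2 := mul_aeval_eq_of_mul_eq_zero huv f'
    simp only [map_add, map_mul, aeval_C, aeval_X]
    linear_combination aeval v h' * h1 + aeval v h * h2

/-- The dimension of the coordinate ring of two fat points of the same shape `g`, one on each
branch of a node, glued at the node. -/
theorem finrank_add_one_of_node {u v : A} (huv : u * v = 0)
    (htop : Algebra.adjoin F {u, v} = ⊤) {g : F[X]} (hg : g ≠ 0) (hg0 : g.eval 0 = 0)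
    (hgu : aeval u g = 0) (hgv : aeval v g = 0)
    (πu πv : A →ₐ[F] AdjoinRoot g)
    (huu : πu u = AdjoinRoot.root g) (huv' : πu v = 0)
    (hvv : πv v = AdjoinRoot.root g) :
    Module.finrank F A + 1 = 2 * g.natDegree := by
  have hgX : g = g.divX * X := by
    conv_lhs => rw [← divX_mul_X_add g]
    rw [coeff_zero_eq_eval_zero, hg0, C_0, add_zero]
  have hdX : g.divX ≠ 0 := by
    intro h
    rw [h, zero_mul] at hgX
    exact hg hgX
  have hdeg : g.natDegree = g.divX.natDegree + 1 := by
    conv_lhs => rw [hgX]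
    exact natDegree_mul_X hdX
  have hroot : ∀ f : F[X], aeval (AdjoinRoot.root g) f = 0 → f.degree < g.degree → f = 0 := by
    intro f hf hlt
    rw [AdjoinRoot.aeval_eq, AdjoinRoot.mk_eq_zero] at hf
    exact eq_zero_of_dvd_of_degree_lt hf hlt
  -- The constants belong to the first summand only. The second one, which carries a factor `v`,
  -- therefore has one dimension fewer; this is the `+ 1` of the conclusion.
  let Φ : (degreeLT F g.natDegree × degreeLT F g.divX.natDegree) →ₗ[F] A :=
    LinearMap.coprod ((aeval u).toLinearMap.comp (degreeLT F _).subtype)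
      ((LinearMap.mulLeft F v).comp ((aeval v).toLinearMap.comp (degreeLT F _).subtype))
  have hΦ : ∀ f h, Φ (f, h) = aeval u f.1 + v * aeval v h.1 := fun f h => rfl
  have hinj : Function.Injective Φ := by
    rw [← LinearMap.ker_eq_bot, LinearMap.ker_eq_bot']
    rintro ⟨⟨f, hf⟩, ⟨h, hh⟩⟩ h0
    change aeval u f + v * aeval v h = 0 at h0
    rw [mem_degreeLT, ← degree_eq_natDegree hg] at hf
    rw [mem_degreeLT, ← degree_eq_natDegree hdX] at hh
    have e1 := congrArg πu h0
    rw [map_add, map_mul, huv', zero_mul, add_zero, map_zero, ← aeval_algHom_apply, huu] at e1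
    have hf0 : f = 0 := hroot f e1 hf
    rw [hf0, map_zero, zero_add] at h0
    have e2 := congrArg πv h0
    rw [map_mul, map_zero, ← aeval_algHom_apply, hvv] at e2
    have e3 : aeval (AdjoinRoot.root g) (h * X) = 0 := by
      rw [map_mul, aeval_X, mul_comm, e2]
    have hh0 : h = 0 := by
      have : h * X = 0 := by
        refine hroot _ e3 ?_
        rw [hgX, degree_mul, degree_mul]
        by_cases hz : h = 0
        · rw [hz, degree_zero, WithBot.bot_add, degree_eq_natDegree hdX, degree_X]
          exact WithBot.bot_lt_coe _
        · rw [degree_eq_natDegree hz, degree_eq_natDegree hdX] at *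
          rw [degree_X]
          exact_mod_cast Nat.succ_lt_succ (by exact_mod_cast hh)
      exact (mul_eq_zero.1 this).resolve_right X_ne_zero
    subst hf0 hh0
    rfl
  have hsurj : Function.Surjective Φ := by
    intro a
    obtain ⟨f, h, rfl⟩ := exists_aeval_add_of_adjoin_eq_top huv htop a
    refine ⟨(⟨f % g, ?_⟩, ⟨h % g.divX, ?_⟩), ?_⟩
    · rw [mem_degreeLT, ← degree_eq_natDegree hg]
      exact EuclideanDomain.mod_lt f hg
    · rw [mem_degreeLT, ← degree_eq_natDegree hdX]
      exact EuclideanDomain.mod_lt h hdX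
    · rw [hΦ]
      have e1 := congrArg (aeval u) (EuclideanDomain.div_add_mod f g)
      have e2 := congrArg (aeval v) (EuclideanDomain.div_add_mod h g.divX)
      have e3 := congrArg (aeval v) hgX
      rw [map_add, map_mul] at e1 e2
      -- Since `v * g.divX(v) = g(v) = 0`, the polynomial `h` in `v * h(v)` matters only modulo
      -- `g.divX`.
      rw [map_mul, hgv, aeval_X] at e3
      rw [hgu] at e1
      linear_combination e1 + v * e2 + aeval v (h / g.divX) * e3
  have hfr := (LinearEquiv.ofBijective Φ ⟨hinj, hsurj⟩).finrank_eq
  rw [Module.finrank_prod, (degreeLTEquiv F _).finrank_eq, (degreeLTEquiv F _).finrank_eq,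
    Module.finrank_fin_fun, Module.finrank_fin_fun] at hfr
  omega

end Node

/-! ### The polynomials `(1 + αx)^L + 1` near zero -/

section ShiftedPowers

variable {F : Type*} [Field F]

/-- The polynomial `(1 + α x) ^ L + 1`. -/
noncomputable def shiftedPow (L : ℕ) (α : F) : F[X] := (1 + C α * X) ^ L + 1

variable [CharP F 2]

theorem two_eq_zero_of_algebra (A : Type*) [CommRing A] [Algebra F A] : (2 : A) = 0 := by
  have h : (2 : F) = 0 := CharTwo.two_eq_zero
  rw [← map_ofNat (algebraMap F A) 2, h, map_zero]

/-- The cofactor is a geometric sum; at `0` it is `L` ones, which add up to `1` in characteristic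
`2`. -/
theorem exists_shiftedPow_eq_of_odd {L : ℕ} (hL : Odd L) (α : F) :
    ∃ w : F[X], shiftedPow L α = C α * X * w ∧ w.eval 0 = 1 := by
  refine ⟨∑ i ∈ Finset.range L, (1 + C α * X) ^ i, ?_, ?_⟩
  · have h := mul_geom_sum (1 + C α * X) L
    have h2 : (2 : F[X]) = 0 := two_eq_zero_of_algebra (F := F) _
    rw [shiftedPow]
    linear_combination h2 - h
  · have : (L : F) = 1 := by
      obtain ⟨k, rfl⟩ := hL
      push_cast
      rw [CharTwo.two_eq_zero, zero_mul, zero_add]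
    simp [eval_finsetSum, this]

theorem shiftedPow_two_pow_mul (r L : ℕ) (α : F) :
    shiftedPow (2 ^ r * L) α = shiftedPow L α ^ 2 ^ r := by
  rw [shiftedPow, shiftedPow, add_pow_char_pow, one_pow, ← pow_mul, mul_comm L]

/-- Here `2 ^ r` is the largest power of `2` dividing `L`. That `r` does not depend on `α` makes the
leading coefficients at `0` comparable. -/
theorem exists_shiftedPow_eq {L : ℕ} (hL : L ≠ 0) :
    ∃ r : ℕ, ∀ α : F, ∃ w : F[X],
      shiftedPow L α = C (α ^ 2 ^ r) * X ^ 2 ^ r * w ∧ w.eval 0 = 1 := by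
  obtain ⟨r, L', hodd, rfl⟩ := Nat.exists_eq_two_pow_mul_odd hL
  refine ⟨r, fun α => ?_⟩
  obtain ⟨w, hw, hw0⟩ := exists_shiftedPow_eq_of_odd hodd α
  refine ⟨w ^ 2 ^ r, ?_, by rw [eval_pow, hw0, one_pow]⟩
  rw [shiftedPow_two_pow_mul, hw, mul_pow, mul_pow, C_pow]

theorem shiftedPow_ne_zero {L : ℕ} (hL : L ≠ 0) {α : F} (hα : α ≠ 0) : shiftedPow L α ≠ 0 := by
  obtain ⟨r, h⟩ := exists_shiftedPow_eq (F := F) hL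
  obtain ⟨w, hw, hw0⟩ := h α
  rw [hw]
  have hwne : w ≠ 0 := by
    rintro rfl
    simp at hw0
  exact mul_ne_zero (mul_ne_zero (C_ne_zero.2 (pow_ne_zero _ hα)) (pow_ne_zero _ X_ne_zero)) hwne

theorem root_pow_two_pow {ω : F} (hω : ω ^ 2 + ω + 1 = 0) (r : ℕ) :
    (ω ^ 2 ^ r) ^ 2 + ω ^ 2 ^ r + 1 = 0 := by
  have h := congrArg (· ^ 2 ^ r) hω
  simp only [add_pow_char_pow, one_pow, zero_pow (pow_ne_zero r two_ne_zero)] at h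
  rw [← h]
  ring

/-- The leading behaviour at `0` of the cofactors of a greatest common divisor of the three
polynomials `shiftedPow L (ω ^ i)`. -/
theorem exists_cofactor_eval_zero {L : ℕ} (hL : L ≠ 0) {ω : F} (hω : ω ^ 2 + ω + 1 = 0)
    {g a b c h0 h1 h2 : F[X]}
    (hg : g = a * shiftedPow L 1 + b * shiftedPow L ω + c * shiftedPow L (ω ^ 2))
    (e0 : shiftedPow L 1 = g * h0) (e1 : shiftedPow L ω = g * h1)
    (e2 : shiftedPow L (ω ^ 2) = g * h2) :
    g.eval 0 = 0 ∧ ∃ η t : F, η ^ 2 + η + 1 = 0 ∧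
      t * h0.eval 0 = 1 ∧ t * h1.eval 0 = η ∧ t * h2.eval 0 = η ^ 2 := by
  obtain ⟨r, hr⟩ := exists_shiftedPow_eq (F := F) hL
  obtain ⟨w0, hw0, hw0'⟩ := hr 1
  obtain ⟨w1, hw1, hw1'⟩ := hr ω
  obtain ⟨w2, hw2, hw2'⟩ := hr (ω ^ 2)
  have hg' : g = X ^ 2 ^ r *
      (a * C (1 ^ 2 ^ r) * w0 + b * C (ω ^ 2 ^ r) * w1 + c * C ((ω ^ 2) ^ 2 ^ r) * w2) := by
    rw [hg, hw0, hw1, hw2]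
    ring
  set g' := a * C (1 ^ 2 ^ r) * w0 + b * C (ω ^ 2 ^ r) * w1 + c * C ((ω ^ 2) ^ 2 ^ r) * w2
  have hX : (X ^ 2 ^ r : F[X]) ≠ 0 := pow_ne_zero _ X_ne_zero
  have key : ∀ (α : F) (h w : F[X]), C (α ^ 2 ^ r) * X ^ 2 ^ r * w = g * h → w.eval 0 = 1 →
      g'.eval 0 * h.eval 0 = α ^ 2 ^ r := by
    intro α h w he hw
    have : g' * h = C (α ^ 2 ^ r) * w := by
      apply mul_left_cancel₀ hX
      rw [← mul_assoc, ← hg', ← he]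
      ring
    rw [← eval_mul, this, eval_mul, eval_C, hw, mul_one]
  refine ⟨?_, ω ^ 2 ^ r, g'.eval 0, root_pow_two_pow hω r, ?_, ?_, ?_⟩
  · rw [hg', eval_mul, eval_pow, eval_X, zero_pow (pow_ne_zero r two_ne_zero), zero_mul]
  · rw [key 1 h0 w0 (hw0.symm.trans e0) hw0', one_pow]
  · exact key ω h1 w1 (hw1.symm.trans e1) hw1'
  · rw [key _ h2 w2 (hw2.symm.trans e2) hw2', pow_right_comm]

omit [CharP F 2] in
theorem aeval_shiftedPow {A : Type*} [CommRing A] [Algebra F A] (L : ℕ) (α : F) (u : A) :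
    aeval u (shiftedPow L α) = (1 + algebraMap F A α * u) ^ L + 1 := by
  simp [shiftedPow]

end ShiftedPowers

/-! ### Powers of `1 + a + b` when `a b = 0` -/

section Vanishing

variable {A : Type*} [CommRing A]

/-- `1 + a + b = (1 + a)(1 + b)`, while `(1 + a)^n - 1` and `(1 + b)^n - 1` are multiples of `a` and
`b`, so their product vanishes. -/
theorem one_add_pow_of_mul_eq_zero {a b : A} (hab : a * b = 0) (n : ℕ) :
    (1 + a + b) ^ n = (1 + a) ^ n + (1 + b) ^ n - 1 := by
  have h1 : (1 + a + b) ^ n = (1 + a) ^ n * (1 + b) ^ n := by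
    rw [← mul_pow]
    congr 1
    linear_combination -hab
  obtain ⟨s, hs⟩ := sub_dvd_pow_sub_pow (1 + a) 1 n
  obtain ⟨t, ht⟩ := sub_dvd_pow_sub_pow (1 + b) 1 n
  rw [one_pow, add_sub_cancel_left] at hs ht
  linear_combination h1 + (1 + b) ^ n * hs - hs + a * s * ht + s * t * hab

theorem mul_one_add_pow_of_mul_eq_zero {u b : A} (hub : u * b = 0) (n : ℕ) :
    u * (1 + b) ^ n = u := by
  obtain ⟨t, ht⟩ := sub_dvd_pow_sub_pow (1 + b) 1 n
  rw [one_pow, add_sub_cancel_left] at ht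
  linear_combination u * ht + t * hub

variable {F : Type*} [Field F] [CharP F 2] [Algebra F A]

theorem aeval_shiftedPow_add {u v : A} (huv : u * v = 0) {L : ℕ} {α β : F}
    (h : (1 + algebraMap F A α * u + algebraMap F A β * v) ^ L = 1) :
    aeval u (shiftedPow L α) + aeval v (shiftedPow L β) = 0 := by
  have h0 : (algebraMap F A α * u) * (algebraMap F A β * v) = 0 := by
    linear_combination algebraMap F A α * algebraMap F A β * huv
  rw [one_add_pow_of_mul_eq_zero h0] at h
  rw [aeval_shiftedPow, aeval_shiftedPow]
  linear_combination h + 2 * two_eq_zero_of_algebra (F := F) A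

theorem mul_aeval_shiftedPow {u v : A} (huv : u * v = 0) {L : ℕ} {α β : F}
    (h : (1 + algebraMap F A α * u + algebraMap F A β * v) ^ L = 1) :
    u * aeval u (shiftedPow L α) = 0 := by
  have h0 : u * (algebraMap F A β * v) = 0 := by
    linear_combination algebraMap F A β * huv
  have h1 := mul_one_add_pow_of_mul_eq_zero h0 L
  have h2 := congrArg (u * ·) (aeval_shiftedPow_add huv h)
  simp only [mul_add, mul_zero] at h2
  rw [aeval_shiftedPow L β] at h2
  linear_combination h2 - h1 - u * two_eq_zero_of_algebra (F := F) A

end Vanishing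

end CubicCode

namespace CubicCode

open Polynomial

/-! ### The node inside the quotient algebra and its dimension -/

section Dimension

variable {F : Type*} [Field F] [CharP F 2] {L : ℕ}

/-- The first nodal coordinate `(x + 1) + ω (y + 1)` of the quotient algebra. -/
noncomputable def nodeCoord (L : ℕ) (ω : F) : PatternQuotient L F :=
  (coordX + 1) + algebraMap F _ ω * (coordY + 1)

omit [CharP F 2] in
theorem root_algebraMap {ω : F} (hω : ω ^ 2 + ω + 1 = 0) (A : Type*) [CommRing A] [Algebra F A] :
    algebraMap F A ω ^ 2 + algebraMap F A ω + 1 = 0 := by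
  rw [← map_pow, ← map_add, ← map_one (algebraMap F A), ← map_add, hω, map_zero]

omit [CharP F 2] in
theorem root_sq {ω : F} (hω : ω ^ 2 + ω + 1 = 0) : (ω ^ 2) ^ 2 = ω := by
  linear_combination (ω ^ 2 - ω) * hω

omit [CharP F 2] in
theorem root_sq_root {ω : F} (hω : ω ^ 2 + ω + 1 = 0) : (ω ^ 2) ^ 2 + ω ^ 2 + 1 = 0 := by
  rw [root_sq hω, add_comm ω, hω]

/-- With `X = x + 1` and `Y = y + 1` the product is `X² + XY + Y²`, which is the quadratic relation
after `z` is eliminated by the linear one. -/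
theorem nodeCoord_mul {ω : F} (hω : ω ^ 2 + ω + 1 = 0) :
    nodeCoord L ω * nodeCoord L (ω ^ 2) = 0 := by
  have hw := root_algebraMap hω (PatternQuotient L F)
  have h2 : (2 : PatternQuotient L F) = 0 := two_eq_zero_of_algebra (F := F) _
  have h := coord_relation_linear (L := L) (F := F)
  have h' := coord_relation_quadratic (L := L) (F := F)
  rw [nodeCoord, nodeCoord, map_pow]
  generalize (coordX : PatternQuotient L F) = x at *
  generalize (coordY : PatternQuotient L F) = y at *
  generalize (coordZ : PatternQuotient L F) = z at *
  generalize algebraMap F (PatternQuotient L F) ω = w at *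
  grind

theorem coordX_eq {ω : F} (hω : ω ^ 2 + ω + 1 = 0) :
    1 + algebraMap F _ (ω ^ 2) * nodeCoord L ω + algebraMap F _ ω * nodeCoord L (ω ^ 2) =
      coordX := by
  have hw := root_algebraMap hω (PatternQuotient L F)
  have h2 : (2 : PatternQuotient L F) = 0 := two_eq_zero_of_algebra (F := F) _
  rw [nodeCoord, nodeCoord, map_pow]
  generalize (coordX : PatternQuotient L F) = x at *
  generalize (coordY : PatternQuotient L F) = y at *
  generalize algebraMap F (PatternQuotient L F) ω = w at *
  grind

theorem coordY_eq {ω : F} (hω : ω ^ 2 + ω + 1 = 0) :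
    1 + algebraMap F _ 1 * nodeCoord L ω + algebraMap F _ 1 * nodeCoord L (ω ^ 2) =
      coordY := by
  have hw := root_algebraMap hω (PatternQuotient L F)
  have h2 : (2 : PatternQuotient L F) = 0 := two_eq_zero_of_algebra (F := F) _
  rw [nodeCoord, nodeCoord, map_pow, map_one]
  generalize (coordX : PatternQuotient L F) = x at *
  generalize (coordY : PatternQuotient L F) = y at *
  generalize algebraMap F (PatternQuotient L F) ω = w at *
  grind

theorem coordZ_eq {ω : F} (hω : ω ^ 2 + ω + 1 = 0) :
    1 + algebraMap F _ ω * nodeCoord L ω + algebraMap F _ (ω ^ 2) * nodeCoord L (ω ^ 2) =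
      coordZ := by
  have hw := root_algebraMap hω (PatternQuotient L F)
  have h2 : (2 : PatternQuotient L F) = 0 := two_eq_zero_of_algebra (F := F) _
  have h := coord_relation_linear (L := L) (F := F)
  rw [nodeCoord, nodeCoord, map_pow]
  generalize (coordX : PatternQuotient L F) = x at *
  generalize (coordY : PatternQuotient L F) = y at *
  generalize (coordZ : PatternQuotient L F) = z at *
  generalize algebraMap F (PatternQuotient L F) ω = w at *
  grind

theorem adjoin_nodeCoord [NeZero L] {ω : F} (hω : ω ^ 2 + ω + 1 = 0) :
    Algebra.adjoin F {nodeCoord L ω, nodeCoord L (ω ^ 2)} = ⊤ := by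
  have h : ∀ α β : F, 1 + algebraMap F (PatternQuotient L F) α * nodeCoord L ω +
      algebraMap F _ β * nodeCoord L (ω ^ 2) ∈
        Algebra.adjoin F {nodeCoord L ω, nodeCoord L (ω ^ 2)} := by
    intro α β
    refine add_mem (add_mem (one_mem _) (mul_mem (Subalgebra.algebraMap_mem _ _) ?_))
      (mul_mem (Subalgebra.algebraMap_mem _ _) ?_) <;>
    exact Algebra.subset_adjoin (by simp)
  refine adjoin_coord _ ?_ ?_ ?_
  · rw [← coordX_eq hω]
    exact h _ _
  · rw [← coordY_eq hω]
    exact h _ _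
  · rw [← coordZ_eq hω]
    exact h _ _

theorem nodeCoord_mul_aeval {ω : F} (hω : ω ^ 2 + ω + 1 = 0) :
    (nodeCoord L ω * aeval (nodeCoord L ω) (shiftedPow L (1 : F)) = 0 ∧
      nodeCoord L ω * aeval (nodeCoord L ω) (shiftedPow L ω) = 0 ∧
      nodeCoord L ω * aeval (nodeCoord L ω) (shiftedPow L (ω ^ 2)) = 0) ∧
    (nodeCoord L (ω ^ 2) * aeval (nodeCoord L (ω ^ 2)) (shiftedPow L (1 : F)) = 0 ∧
      nodeCoord L (ω ^ 2) * aeval (nodeCoord L (ω ^ 2)) (shiftedPow L ω) = 0 ∧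
      nodeCoord L (ω ^ 2) * aeval (nodeCoord L (ω ^ 2)) (shiftedPow L (ω ^ 2)) = 0) := by
  have huv := nodeCoord_mul (L := L) hω
  have hvu : nodeCoord L (ω ^ 2) * nodeCoord L ω = 0 := by rw [mul_comm, huv]
  have hx := (congrArg (· ^ L) (coordX_eq (L := L) hω)).trans coordX_pow
  have hy := (congrArg (· ^ L) (coordY_eq (L := L) hω)).trans coordY_pow
  have hz := (congrArg (· ^ L) (coordZ_eq (L := L) hω)).trans coordZ_pow
  refine ⟨⟨mul_aeval_shiftedPow huv hy, mul_aeval_shiftedPow huv hz, mul_aeval_shiftedPow huv hx⟩,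
    ?_⟩
  simp only [add_right_comm _ (_ * nodeCoord L ω)] at hx hy hz
  exact ⟨mul_aeval_shiftedPow hvu hy, mul_aeval_shiftedPow hvu hx, mul_aeval_shiftedPow hvu hz⟩

omit [CharP F 2] in
theorem mul_aeval_cofactor {A : Type*} [CommRing A] [Algebra F A] {u : A} {g : F[X]}
    (hu : u * aeval u g = 0) (h : F[X]) :
    aeval u (g * h) = algebraMap F A (h.eval 0) * aeval u g := by
  rw [map_mul, aeval_eq_mul_aeval_divX_add u h]
  linear_combination aeval u h.divX * hu

/-- Because `u g(u) = 0` and `v g(v) = 0`, a cofactor acts on `g(u)` and `g(v)` through its value at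
`0`. After rescaling, `y^L = 1` and `x^L = 1` read `g(u) + g(v) = 0` and `η² g(u) + η g(v) = 0`. The
determinant `η + η²` is `1`, so both vanish. -/
theorem aeval_nodeCoord_eq_zero (hL : L ≠ 0) {ω : F} (hω : ω ^ 2 + ω + 1 = 0)
    {g a b c h0 h1 h2 : F[X]}
    (hg : g = a * shiftedPow L 1 + b * shiftedPow L ω + c * shiftedPow L (ω ^ 2))
    (e0 : shiftedPow L 1 = g * h0) (e1 : shiftedPow L ω = g * h1)
    (e2 : shiftedPow L (ω ^ 2) = g * h2) :
    aeval (nodeCoord L ω) g = 0 ∧ aeval (nodeCoord L (ω ^ 2)) g = 0 := by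
  obtain ⟨-, η, t, hη, ht0, ht1, ht2⟩ := exists_cofactor_eval_zero hL hω hg e0 e1 e2
  obtain ⟨⟨hu0, hu1, hu2⟩, hv0, hv1, hv2⟩ := nodeCoord_mul_aeval (L := L) hω
  have huv := nodeCoord_mul (L := L) hω
  have hx := (congrArg (· ^ L) (coordX_eq (L := L) hω)).trans coordX_pow
  have hy := (congrArg (· ^ L) (coordY_eq (L := L) hω)).trans coordY_pow
  have k1 := aeval_shiftedPow_add huv hx
  have k2 := aeval_shiftedPow_add huv hy
  set u := nodeCoord L ω
  set v := nodeCoord L (ω ^ 2)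
  have hu : u * aeval u g = 0 := by
    rw [hg]
    simp only [map_add, map_mul]
    linear_combination aeval u a * hu0 + aeval u b * hu1 + aeval u c * hu2
  have hv : v * aeval v g = 0 := by
    rw [hg]
    simp only [map_add, map_mul]
    linear_combination aeval v a * hv0 + aeval v b * hv1 + aeval v c * hv2
  rw [e2, e1, mul_aeval_cofactor hu, mul_aeval_cofactor hv] at k1
  rw [e0, mul_aeval_cofactor hu, mul_aeval_cofactor hv] at k2
  have m0 := congrArg (algebraMap F (PatternQuotient L F)) ht0
  have m1 := congrArg (algebraMap F (PatternQuotient L F)) ht1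
  have m2 := congrArg (algebraMap F (PatternQuotient L F)) ht2
  simp only [map_mul, map_pow, map_one] at m0 m1 m2
  have hw := root_algebraMap hη (PatternQuotient L F)
  have h2 : (2 : PatternQuotient L F) = 0 := two_eq_zero_of_algebra (F := F) _
  generalize algebraMap F (PatternQuotient L F) η = w at *
  generalize algebraMap F (PatternQuotient L F) t = s at *
  have n1 : w ^ 2 * aeval u g + w * aeval v g = 0 := by
    linear_combination s * k1 - aeval u g * m2 - aeval v g * m1
  have n2 : aeval u g + aeval v g = 0 := by
    linear_combination s * k2 - aeval u g * m0 - aeval v g * m0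
  have n3 : aeval u g = 0 := by
    linear_combination -n1 + w * n2 + aeval u g * hw - w * aeval u g * h2
  exact ⟨n3, by linear_combination n2 - n3⟩

/-- Restriction to the branch `v = 0`: the images of `x, y, z` are `1 + αt` with `α = ω², 1, ω`. -/
theorem exists_algHom_adjoinRoot [NeZero L] {ω : F} (hω : ω ^ 2 + ω + 1 = 0) {g : F[X]}
    (d0 : g ∣ shiftedPow L 1) (d1 : g ∣ shiftedPow L ω) (d2 : g ∣ shiftedPow L (ω ^ 2)) :
    ∃ f : PatternQuotient L F →ₐ[F] AdjoinRoot g,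
      f (nodeCoord L ω) = AdjoinRoot.root g ∧ f (nodeCoord L (ω ^ 2)) = 0 := by
  have hw := root_algebraMap hω (AdjoinRoot g)
  have h2 : (2 : AdjoinRoot g) = 0 := two_eq_zero_of_algebra (F := F) _
  have key : ∀ α : F, g ∣ shiftedPow L α →
      (1 + algebraMap F _ α * AdjoinRoot.root g) ^ L = 1 := by
    intro α hα
    have h := AdjoinRoot.mk_eq_zero.2 hα
    rw [← AdjoinRoot.aeval_eq, aeval_shiftedPow] at h
    linear_combination h - h2
  obtain ⟨f, hfx, hfy, -⟩ := exists_patternLift (F := F) _ _ _ (key _ d2) (key _ d0) (key _ d1)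
    (by
      rw [map_pow, map_one]
      generalize AdjoinRoot.root g = t at *
      generalize algebraMap F (AdjoinRoot g) ω = w at *
      grind)
    (by
      rw [map_pow, map_one]
      generalize AdjoinRoot.root g = t at *
      generalize algebraMap F (AdjoinRoot g) ω = w at *
      grind)
  refine ⟨f, ?_, ?_⟩
  · simp only [nodeCoord, map_add, map_mul, AlgHom.commutes, map_one, map_pow, hfx, hfy]
    generalize AdjoinRoot.root g = t at *
    generalize algebraMap F (AdjoinRoot g) ω = w at *
    grind
  · simp only [nodeCoord, map_add, map_mul, AlgHom.commutes, map_one, map_pow, hfx, hfy]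
    generalize AdjoinRoot.root g = t at *
    generalize algebraMap F (AdjoinRoot g) ω = w at *
    grind

theorem finrank_patternQuotient_add_one [NeZero L] {ω : F} (hω : ω ^ 2 + ω + 1 = 0)
    {g a b c : F[X]}
    (hg : g = a * shiftedPow L 1 + b * shiftedPow L ω + c * shiftedPow L (ω ^ 2))
    (d0 : g ∣ shiftedPow L 1) (d1 : g ∣ shiftedPow L ω) (d2 : g ∣ shiftedPow L (ω ^ 2)) :
    Module.finrank F (PatternQuotient L F) + 1 = 2 * g.natDegree := by
  have hL : L ≠ 0 := NeZero.ne L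
  have hg0 : g ≠ 0 := by
    rintro rfl
    exact shiftedPow_ne_zero hL one_ne_zero (zero_dvd_iff.1 d0)
  obtain ⟨πu, hu, hu'⟩ := exists_algHom_adjoinRoot hω d0 d1 d2
  -- The other branch is the same statement for the conjugate root `ω²`, whose square is `ω`.
  obtain ⟨πv, hv, hv'⟩ := exists_algHom_adjoinRoot (root_sq_root hω) d0 d2
    (by rwa [root_sq hω])
  obtain ⟨h0, e0⟩ := d0
  obtain ⟨h1, e1⟩ := d1
  obtain ⟨h2, e2⟩ := d2
  obtain ⟨hgu, hgv⟩ := aeval_nodeCoord_eq_zero hL hω hg e0 e1 e2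
  exact finrank_add_one_of_node (nodeCoord_mul hω) (adjoin_nodeCoord hω) hg0
    (exists_cofactor_eval_zero hL hω hg e0 e1 e2).1 hgu hgv πu πv hu hu' hv

end Dimension

end CubicCode

namespace CubicCode

open Polynomial

/-! ### The degree of the gcd, in general and for special lengths -/

section GcdDegree

variable {ω : GaloisField 2 2} {L : ℕ}

theorem exists_root : ∃ ω : GaloisField 2 2, ω ^ 2 + ω + 1 = 0 := by
  classical
  have := Fintype.ofFinite (GaloisField 2 2)
  have hcard : Fintype.card (GaloisField 2 2) = 4 := by
    rw [← Nat.card_eq_fintype_card, GaloisField.card 2 2 two_ne_zero]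
    rfl
  obtain ⟨ω, hω⟩ : ∃ ω : GaloisField 2 2, ω ∉ ({0, 1} : Finset (GaloisField 2 2)) := by
    by_contra! h
    have h1 := Finset.card_le_card (fun x _ => h x : Finset.univ ⊆ _)
    rw [Finset.card_univ, hcard] at h1
    exact absurd (h1.trans Finset.card_le_two) (by norm_num)
  refine ⟨ω, ?_⟩
  have h4 := FiniteField.pow_card ω
  rw [hcard] at h4
  simp only [Finset.mem_insert, Finset.mem_singleton, not_or] at hω
  have : ω * ((ω - 1) * (ω ^ 2 + ω + 1)) = 0 := by
    linear_combination h4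
  exact ((mul_eq_zero.1 ((mul_eq_zero.1 this).resolve_left hω.1)).resolve_left
    (sub_ne_zero.2 hω.2))

/-- The degree of the greatest common divisor is that of any common divisor which lies in the
ideal generated by the three polynomials. -/
theorem gcdDegree_eq_natDegree {d a b c : (GaloisField 2 2)[X]}
    (hd : d = a * shiftedPow L 1 + b * shiftedPow L ω + c * shiftedPow L (ω ^ 2))
    (d0 : d ∣ shiftedPow L 1) (d1 : d ∣ shiftedPow L ω) (d2 : d ∣ shiftedPow L (ω ^ 2)) :
    gcdDegree ω L = d.natDegree := by
  classical
  have h1 : ((1 + X) ^ L + 1 : (GaloisField 2 2)[X]) = shiftedPow L 1 := by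
    rw [shiftedPow, C_1, one_mul]
  rw [gcdDegree, h1]
  refine natDegree_eq_of_degree_eq (degree_eq_degree_of_associated
    (associated_of_dvd_dvd ?_ ?_))
  · rw [hd]
    refine dvd_add (dvd_add ?_ ?_) ?_ <;> refine Dvd.dvd.mul_left ?_ _
    · exact (EuclideanDomain.gcd_dvd_left _ _).trans (EuclideanDomain.gcd_dvd_left _ _)
    · exact (EuclideanDomain.gcd_dvd_left _ _).trans (EuclideanDomain.gcd_dvd_right _ _)
    · exact EuclideanDomain.gcd_dvd_right _ _
  · exact EuclideanDomain.dvd_gcd (EuclideanDomain.dvd_gcd d0 d1) d2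

theorem exists_gcd (ω : GaloisField 2 2) (L : ℕ) : ∃ g a b c : (GaloisField 2 2)[X],
    g = a * shiftedPow L 1 + b * shiftedPow L ω + c * shiftedPow L (ω ^ 2) ∧
    g ∣ shiftedPow L 1 ∧ g ∣ shiftedPow L ω ∧ g ∣ shiftedPow L (ω ^ 2) := by
  classical
  set P := shiftedPow L (1 : GaloisField 2 2)
  set Q := shiftedPow L ω
  set R := shiftedPow L (ω ^ 2)
  refine ⟨EuclideanDomain.gcd (EuclideanDomain.gcd P Q) R,
    EuclideanDomain.gcdA P Q * EuclideanDomain.gcdA (EuclideanDomain.gcd P Q) R,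
    EuclideanDomain.gcdB P Q * EuclideanDomain.gcdA (EuclideanDomain.gcd P Q) R,
    EuclideanDomain.gcdB (EuclideanDomain.gcd P Q) R, ?_,
    (EuclideanDomain.gcd_dvd_left _ _).trans (EuclideanDomain.gcd_dvd_left _ _),
    (EuclideanDomain.gcd_dvd_left _ _).trans (EuclideanDomain.gcd_dvd_right _ _),
    EuclideanDomain.gcd_dvd_right _ _⟩
  have h1 := EuclideanDomain.gcd_eq_gcd_ab P Q
  have h2 := EuclideanDomain.gcd_eq_gcd_ab (EuclideanDomain.gcd P Q) R
  linear_combination h2 + EuclideanDomain.gcdA (EuclideanDomain.gcd P Q) R * h1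

theorem finrank_patternKernel_add_one [NeZero L] (hω : ω ^ 2 + ω + 1 = 0) :
    Module.finrank (ZMod 2) (patternKernel L (ZMod 2) (ZMod 2)) + 1 = 2 * gcdDegree ω L := by
  obtain ⟨g, a, b, c, hg, d0, d1, d2⟩ := exists_gcd ω L
  rw [gcdDegree_eq_natDegree hg d0 d1 d2, ← finrank_patternQuotient_add_one hω hg d0 d1 d2,
    finrank_patternQuotient, finrank_patternKernel_of_algebra L (ZMod 2) (GaloisField 2 2)]

/-- Frobenius raises the Bézout identity and the three divisibilities to the power `2 ^ r`. -/
theorem gcdDegree_two_pow_mul (ω : GaloisField 2 2) (r L : ℕ) :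
    gcdDegree ω (2 ^ r * L) = 2 ^ r * gcdDegree ω L := by
  obtain ⟨g, a, b, c, hg, d0, d1, d2⟩ := exists_gcd ω L
  rw [gcdDegree_eq_natDegree hg d0 d1 d2, ← natDegree_pow]
  refine gcdDegree_eq_natDegree (a := a ^ 2 ^ r) (b := b ^ 2 ^ r) (c := c ^ 2 ^ r) ?_ ?_ ?_ ?_
  · simp only [shiftedPow_two_pow_mul]
    rw [hg, add_pow_char_pow, add_pow_char_pow, mul_pow, mul_pow, mul_pow]
  all_goals
    rw [shiftedPow_two_pow_mul]
    exact pow_dvd_pow_of_dvd ‹_› _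

theorem gcdDegree_two_pow (ω : GaloisField 2 2) (p : ℕ) : gcdDegree ω (2 ^ p) = 2 ^ p := by
  have h2 : (2 : (GaloisField 2 2)[X]) = 0 := two_eq_zero_of_algebra (F := GaloisField 2 2) _
  have h : ∀ α : GaloisField 2 2, shiftedPow (2 ^ p) α = C α ^ 2 ^ p * X ^ 2 ^ p := by
    intro α
    rw [shiftedPow, add_pow_char_pow, one_pow, mul_pow]
    linear_combination h2
  rw [gcdDegree_eq_natDegree (d := X ^ 2 ^ p) (a := 1) (b := 0) (c := 0), natDegree_X_pow]
  · rw [h, C_1]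
    ring
  all_goals
    rw [h]
    exact Dvd.intro_left _ rfl

theorem X_dvd_shiftedPow {F : Type*} [Field F] [CharP F 2] (L : ℕ) (α : F) :
    X ∣ shiftedPow L α := by
  rw [X_dvd_iff, coeff_zero_eq_eval_zero]
  simp [shiftedPow, CharTwo.add_self_eq_zero]

/-- The greatest common divisor is `X` as soon as `X` lies in the ideal generated by the three
polynomials. -/
theorem gcdDegree_eq_one {a b c : (GaloisField 2 2)[X]}
    (hd : X = a * shiftedPow L 1 + b * shiftedPow L ω + c * shiftedPow L (ω ^ 2)) :
    gcdDegree ω L = 1 := by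
  rw [gcdDegree_eq_natDegree hd (X_dvd_shiftedPow _ _) (X_dvd_shiftedPow _ _)
    (X_dvd_shiftedPow _ _), natDegree_X]

theorem root_pow_four_pow {F : Type*} [Field F] {ω : F} (hω : ω ^ 2 + ω + 1 = 0) (p : ℕ) :
    ω ^ 4 ^ p = ω := by
  induction p with
  | zero => rw [pow_zero, pow_one]
  | succ p ih =>
    rw [pow_succ, pow_mul, ih]
    linear_combination (ω ^ 2 - ω) * hω

theorem root_pow_two_pow_odd {F : Type*} [Field F] {ω : F} (hω : ω ^ 2 + ω + 1 = 0) (p : ℕ) :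
    ω ^ 2 ^ (2 * p + 1) = ω ^ 2 := by
  rw [pow_succ, pow_mul, pow_mul, show 2 ^ 2 = 4 from rfl, root_pow_four_pow hω]

theorem root_pow_two_pow_eq {F : Type*} [Field F] {ω : F} (hω : ω ^ 2 + ω + 1 = 0) (p : ℕ) :
    ω ^ 2 ^ p = ω ∨ ω ^ 2 ^ p = ω ^ 2 := by
  obtain ⟨m, rfl | rfl⟩ := Nat.even_or_odd' p
  · left
    rw [pow_mul, show 2 ^ 2 = 4 from rfl, root_pow_four_pow hω]
  · exact Or.inr (root_pow_two_pow_odd hω m)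

theorem shiftedPow_two_pow_add_one {F : Type*} [Field F] [CharP F 2] (p : ℕ) (α : F) :
    shiftedPow (2 ^ p + 1) α =
      C α * X + C (α ^ 2 ^ p) * X ^ 2 ^ p + C (α ^ 2 ^ p) * C α * X ^ 2 ^ p * X := by
  have h2 : (2 : F[X]) = 0 := two_eq_zero_of_algebra (F := F) _
  rw [shiftedPow, pow_succ, add_pow_char_pow, one_pow, mul_pow, ← C_pow]
  linear_combination h2

/-- Multiplying by `1 + αX` completes the exponent to a power of `2`, where Frobenius applies. -/
theorem mul_shiftedPow_pred {F : Type*} [Field F] [CharP F 2] {p L : ℕ} (hL : L + 1 = 2 ^ p)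
    (α : F) :
    (1 + C α * X) * shiftedPow L α = C (α ^ 2 ^ p) * X ^ 2 ^ p + C α * X := by
  have h2 : (2 : F[X]) = 0 := two_eq_zero_of_algebra (F := F) _
  have h : (1 + C α * X) ^ (L + 1) = 1 + C (α ^ 2 ^ p) * X ^ 2 ^ p := by
    rw [hL, add_pow_char_pow, one_pow, mul_pow, ← C_pow]
  rw [shiftedPow]
  linear_combination h + h2

theorem root_C {F : Type*} [Field F] {ω : F} (hω : ω ^ 2 + ω + 1 = 0) :
    C ω ^ 2 + C ω + 1 = 0 := by
  rw [← C_pow, ← C_add, ← C_1, ← C_add, hω, C_0]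

theorem gcdDegree_two_pow_add_one (hω : ω ^ 2 + ω + 1 = 0) {p : ℕ} (hp : 1 ≤ p) :
    gcdDegree ω (2 ^ p + 1) = 1 := by
  have h2 : (2 : (GaloisField 2 2)[X]) = 0 := two_eq_zero_of_algebra (F := GaloisField 2 2) _
  have hw := root_C hω
  have h0 := shiftedPow_two_pow_add_one p (1 : GaloisField 2 2)
  have h1 := shiftedPow_two_pow_add_one p ω
  have h2' := shiftedPow_two_pow_add_one p (ω ^ 2)
  rw [one_pow, C_1] at h0
  obtain h | h := root_pow_two_pow_eq hω p
  · obtain ⟨n, hn⟩ : ∃ n, 2 ^ p = n + 2 :=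
      Nat.exists_eq_add_of_le' (Nat.le_self_pow (by omega) 2)
    have hX : (X : (GaloisField 2 2)[X]) ^ 2 ^ p = X ^ n * X ^ 2 := by rw [hn, pow_add]
    rw [h, hX] at h1
    rw [hX] at h0
    -- The coefficients come from `X ^ (2 ^ p + 1) = shiftedPow _ ω + ω * shiftedPow _ 1`.
    refine gcdDegree_eq_one
      (a := (1 + X * X ^ n) - (1 + X * X ^ n + X ^ n) * C ω)
      (b := -(1 + X * X ^ n + X ^ n)) (c := 0) ?_
    rw [h0, h1]
    generalize C ω = w at *
    generalize (X : (GaloisField 2 2)[X]) ^ n = M at *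
    generalize (X : (GaloisField 2 2)[X]) = x at *
    grind
  · rw [h] at h1
    rw [pow_right_comm, h, root_sq hω] at h2'
    -- With these weights the three linear coefficients are all `1` and sum to `1`, whereas those of
    -- `X ^ 2 ^ p` and `X ^ (2 ^ p + 1)` sum to `1 + ω + ω² = 0`.
    refine gcdDegree_eq_one (a := 1) (b := C ω ^ 2) (c := C ω) ?_
    rw [h0, h1, h2', C_pow]
    generalize C ω = w at *
    generalize (X : (GaloisField 2 2)[X]) ^ 2 ^ p = M at *
    generalize (X : (GaloisField 2 2)[X]) = x at *
    grind

theorem gcdDegree_two_pow_odd_sub_one (hω : ω ^ 2 + ω + 1 = 0) {p L : ℕ}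
    (hL : L + 1 = 2 ^ (2 * p + 1)) : gcdDegree ω L = 1 := by
  have h2 : (2 : (GaloisField 2 2)[X]) = 0 := two_eq_zero_of_algebra (F := GaloisField 2 2) _
  have hw := root_C hω
  have h0 := mul_shiftedPow_pred hL (1 : GaloisField 2 2)
  have h1 := mul_shiftedPow_pred hL ω
  rw [one_pow, C_1] at h0
  rw [root_pow_two_pow_odd hω, C_pow] at h1
  -- The products `(1 + X) * shiftedPow L 1` and `(1 + ωX) * shiftedPow L ω` are `X^N + X` and
  -- `ω²X^N + ωX`. Weighting the first by `ω²` cancels `X^N` and leaves `(ω² + ω)X = X`.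
  refine gcdDegree_eq_one (a := C ω ^ 2 * (1 + X)) (b := 1 + C ω * X) (c := 0) ?_
  linear_combination -X * hw - C ω ^ 2 * h0 - h1 + X * h2 - X ^ 2 ^ (2 * p + 1) * C ω ^ 2 * h2

theorem one_add_cube_eq {A : Type*} [CommRing A] {w : A} (hw : w ^ 2 + w + 1 = 0) (x : A) :
    1 + x ^ 3 = (1 + x) * (1 + w * x) * (1 + w ^ 2 * x) := by
  linear_combination -(x + w * x ^ 2 + (w - 1) * x ^ 3) * hw

theorem one_eq_sum_of_root {A : Type*} [CommRing A] {w : A} (hw : w ^ 2 + w + 1 = 0)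
    (h2 : (2 : A) = 0) (x : A) :
    1 = (1 + w * x) * (1 + w ^ 2 * x) + w ^ 2 * (w * (1 + x) * (1 + w ^ 2 * x)) +
      w * (w ^ 2 * (1 + x) * (1 + w * x)) := by
  grind

/-- Since `α ^ 4 ^ p = α`, each `(1 + αX) * shiftedPow L α` is a multiple of the same `X^(L+1) + X =
(1 + X³) Q`. Each polynomial is thus `αQ` times two of the three linear factors of `1 + X³`. By
`one_eq_sum_of_root` these pairwise products generate the unit ideal, so the gcd is `Q`, of degree
`L + 1 - 3`. -/
theorem gcdDegree_four_pow_sub_one (hω : ω ^ 2 + ω + 1 = 0) {p L : ℕ} (hp : 1 ≤ p)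
    (hL : L + 1 = 4 ^ p) : gcdDegree ω L + 2 = L := by
  have h2 : (2 : (GaloisField 2 2)[X]) = 0 := two_eq_zero_of_algebra (F := GaloisField 2 2) _
  have hw := root_C hω
  have h4 : 4 ^ p = 2 ^ (2 * p) := by rw [pow_mul]; norm_num
  have hL' := hL.trans h4
  have h0 := mul_shiftedPow_pred hL' (1 : GaloisField 2 2)
  have h1 := mul_shiftedPow_pred hL' ω
  have h2' := mul_shiftedPow_pred hL' (ω ^ 2)
  rw [← h4] at h0 h1 h2'
  rw [one_pow, C_1, one_mul, one_mul] at h0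
  rw [root_pow_four_pow hω] at h1
  rw [root_pow_four_pow (root_sq_root hω)] at h2'
  obtain ⟨m, hm⟩ : ∃ m, L = 3 * m := by
    have h3 : 4 ^ p ≡ 1 [MOD 3] := by simpa using (show 4 ≡ 1 [MOD 3] from rfl).pow p
    have : L % 3 = 0 := by
      have h5 : (L + 1) % 3 = 1 := by rw [hL]; exact h3
      omega
    exact ⟨L / 3, by omega⟩
  obtain ⟨s, hs⟩ := sub_dvd_pow_sub_pow ((X : (GaloisField 2 2)[X]) ^ 3) 1 m
  have hN : (X : (GaloisField 2 2)[X]) ^ 4 ^ p + X = (1 + X ^ 3) * (X * s) := by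
    rw [← hL, pow_succ, hm, pow_mul]
    rw [one_pow] at hs
    linear_combination X * hs + X * h2 - X * s * h2
  have hne : ∀ α : GaloisField 2 2, 1 + C α * X ≠ 0 := by
    intro α h
    simpa using congrArg (eval 0) h
  set Q := X * s
  have hX3 : (1 + X ^ 3 : (GaloisField 2 2)[X]) =
      (1 + X) * (1 + C ω * X) * (1 + C ω ^ 2 * X) :=
    one_add_cube_eq hw X
  have f0 : shiftedPow L 1 = (1 + C ω * X) * (1 + C ω ^ 2 * X) * Q := by
    apply mul_left_cancel₀ (hne 1)
    rw [C_1, one_mul, h0, hN, hX3]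
    ring
  have f1 : shiftedPow L ω = C ω * (1 + X) * (1 + C ω ^ 2 * X) * Q := by
    apply mul_left_cancel₀ (hne ω)
    rw [h1, ← mul_add, hN, hX3]
    ring
  have f2 : shiftedPow L (ω ^ 2) = C ω ^ 2 * (1 + X) * (1 + C ω * X) * Q := by
    apply mul_left_cancel₀ (hne (ω ^ 2))
    rw [h2', ← mul_add, hN, hX3, C_pow]
    ring
  rw [gcdDegree_eq_natDegree (d := Q) (a := 1) (b := C ω ^ 2) (c := C ω)]
  · have hdeg := congrArg natDegree hN
    have hq : 4 ≤ 4 ^ p := Nat.le_self_pow (by omega) 4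
    have hd1 : ((X : (GaloisField 2 2)[X]) ^ 4 ^ p + X).natDegree = 4 ^ p := by
      rw [natDegree_add_eq_left_of_natDegree_lt, natDegree_X_pow]
      rw [natDegree_X_pow, natDegree_X]
      omega
    have hd3 : (1 + X ^ 3 : (GaloisField 2 2)[X]).natDegree = 3 := by
      rw [natDegree_add_eq_right_of_natDegree_lt, natDegree_X_pow]
      rw [natDegree_X_pow, natDegree_one]
      omega
    have hQ0 : Q ≠ 0 := by
      intro h
      rw [h, mul_zero] at hN
      rw [hN, natDegree_zero] at hd1
      omega
    have h30 : (1 + X ^ 3 : (GaloisField 2 2)[X]) ≠ 0 := by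
      intro h
      rw [h, natDegree_zero] at hd3
      omega
    rw [hd1, natDegree_mul h30 hQ0, hd3] at hdeg
    omega
  · rw [f0, f1, f2]
    linear_combination Q * one_eq_sum_of_root hw h2 X
  · rw [f0]
    exact Dvd.intro_left _ rfl
  · rw [f1]
    exact Dvd.intro_left _ rfl
  · rw [f2]
    exact Dvd.intro_left _ rfl

end GcdDegree

end CubicCode

open CubicCode

theorem mainTheorem6 :
    ∃ k : ℕ → ℕ,
      (∀ (L : ℕ) [NeZero L],
        CubicCode.HasGroundStateDegeneracy (CubicCode.hamiltonian L) (2 ^ k L)) ∧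
      (∀ ω : GaloisField 2 2, ω ^ 2 + ω + 1 = 0 → ∀ L : ℕ, 1 ≤ L →
        ((k L : ℚ) + 2) / 4 = (CubicCode.gcdDegree ω L : ℚ)) ∧
      (∀ p L : ℕ, 1 ≤ p → L = 2 ^ p + 1 → ((k L : ℚ) + 2) / 4 = 1) ∧
      (∀ p L : ℕ, 1 ≤ p → L = 2 ^ p → ((k L : ℚ) + 2) / 4 = (L : ℚ)) ∧
      (∀ p L : ℕ, 1 ≤ p → L = 4 ^ p - 1 → ((k L : ℚ) + 2) / 4 = (L : ℚ) - 2) ∧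
      (∀ p L : ℕ, 1 ≤ p → L = 2 ^ (2 * p + 1) - 1 → ((k L : ℚ) + 2) / 4 = 1) ∧
      (∀ r L' : ℕ, 1 ≤ L' → k (2 ^ r * L') + 2 = 2 ^ r * (k L' + 2)) := by
  obtain ⟨k, hkdef⟩ : ∃ k : ℕ → ℕ, ∀ L,
      k L = 2 * Module.finrank (ZMod 2) (patternKernel L (ZMod 2) (ZMod 2)) :=
    ⟨_, fun _ => rfl⟩
  have hk : ∀ ω : GaloisField 2 2, ω ^ 2 + ω + 1 = 0 → ∀ L : ℕ, 1 ≤ L →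
      k L + 2 = 4 * gcdDegree ω L := by
    intro ω hω L hL
    have : NeZero L := ⟨by omega⟩
    have := finrank_patternKernel_add_one (L := L) hω
    rw [hkdef]
    omega
  have hk' : ∀ ω : GaloisField 2 2, ω ^ 2 + ω + 1 = 0 → ∀ L : ℕ, 1 ≤ L →
      ((k L : ℚ) + 2) / 4 = (gcdDegree ω L : ℚ) := by
    intro ω hω L hL
    have h : (k L : ℚ) + 2 = 4 * gcdDegree ω L := by exact_mod_cast hk ω hω L hL
    rw [h]
    ring
  obtain ⟨ω, hω⟩ := exists_root
  refine ⟨k, fun L _ => hkdef L ▸ hasGroundStateDegeneracy_hamiltonian L, hk', ?_, ?_, ?_, ?_, ?_⟩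
  · rintro p L hp rfl
    rw [hk' ω hω _ (Nat.le_add_left 1 _), gcdDegree_two_pow_add_one hω hp, Nat.cast_one]
  · rintro p L hp rfl
    rw [hk' ω hω _ Nat.one_le_two_pow, gcdDegree_two_pow]
  · intro p L hp hL
    have hq : 4 ≤ 4 ^ p := Nat.le_self_pow (by omega) 4
    have h := gcdDegree_four_pow_sub_one hω hp (show L + 1 = 4 ^ p by omega)
    have h' : (gcdDegree ω L : ℚ) + 2 = L := by exact_mod_cast h
    rw [hk' ω hω _ (by omega), ← h', add_sub_cancel_right]
  · intro p L hp hL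
    have hq : 2 ≤ 2 ^ (2 * p + 1) := Nat.le_self_pow (by omega) 2
    rw [hk' ω hω _ (by omega), gcdDegree_two_pow_odd_sub_one hω
      (show L + 1 = 2 ^ (2 * p + 1) by omega), Nat.cast_one]
  · intro r L' hL'
    rw [hk ω hω _ (Nat.mul_pos (Nat.two_pow_pos r) hL'), hk ω hω _ hL', gcdDegree_two_pow_mul]
    ring
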